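/- **Setting.** Let $d\ge 0$ and let $\mathcal M$ be a $2d$-dimensional smooth manifold (Hausdorff, $\sigma$-compact) with an $O(d,d)$ pairing $\langle\cdot,\cdot\rangle$ of one-forms: around each point there are local coordinates $X^A$, $A=1,\dots,2d$, in which $\langle \mathrm dX^A,\mathrm dX^B\rangle=\eta^{AB}$ is the constant matrix $\begin{pmatrix}0&1_d\\1_d&0\end{pmatrix}$. A *DFT algebroid* over $\mathcal M$ is a smooth real vector bundle $L\to\mathcal M$ of rank $2d$ with an $\mathbb R$-bilinear skew-symmetric bracket $[\![\cdot,\cdot]\!]$ on $\Gamma(L)$, a smooth nondegenerate symmetric bilinear form $\langle\cdot,\cdot\rangle$ on the fibres of $L$, and a smooth bundle map $\rho:L\to T\mathcal M$, such that, with $\mathcal D:C^\infty(\mathcal M)\to\Gamma(L)$ defined by $\langle\mathcal Df,e\rangle=\tfrac12\rho(e)f$, for all $e_i\in\Gamma(L)$ and $f,g\in C^\infty(\mathcal M)$: 1. $\langle\mathcal Df,\mathcal Dg\rangle=\tfrac14\langle \mathrm df,\mathrm dg\rangle$; 2. $[\![e_1,f e_2]\!]=f[\![e_1,e_2]\!]+(\rho(e_1)f)\,e_2-\langle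 e_1,e_2\rangle\,\mathcal Df$; 3. $\langle[\![e_3,e_1]\!]+\mathcal D\langle e_3,e_1\rangle,e_2\rangle+\langle e_1,[\![e_3,e_2]\!]+\mathcal D\langle e_3,e_2\rangle\rangle=\rho(e_3)\langle e_1,e_2\rangle$. Put $\mathcal N(e_1,e_2,e_3)=\tfrac13\big(\langle[\![e_1,e_2]\!],e_3\rangle+\langle[\![e_2,e_3]\!],e_1\rangle+\langle[\![e_3,e_1]\!],e_2\rangle\big)$ and $\mathrm{Jac}(e_1,e_2,e_3)=[\![[\![e_1,e_2]\!],e_3]\!]+[\![[\![e_2,e_3]\!],e_1]\!]+[\![[\![e_3,e_1]\!],e_2]\!]$. A (possibly curved) *$L_\infty$-algebra* is a $\mathbb Z$-graded real vector space $\mathsf L$ with multilinear maps $\mu_n:\mathsf L^{\times n}\to\mathsf L$ of degree $2-n$, $n\ge0$, that are graded totally antisymmetric, $\mu_n(\dots,l_r,l_{r+1},\dots)=(-1)^{|l_r||l_{r+1}|+1}\mu_n(\dots,l_{r+1},l_r,\dots)$, and satisfy for all $n\ge0$ and homogeneous $l_1,\dots,l_n$ the homotopy Jacobi identity $$\sum_{j+k=n}\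 \sum_{\sigma}\chi(\sigma;l_1,\dots,l_n)(-1)^k\mu_{k+1}\big(\mu_j(l_{\sigma(1)},\dots,l_{\sigma(j)}),l_{\sigma(j+1)},\dots,l_{\sigma(n)}\big)=0,$$ where $\sigma$ runs over the permutations with $\sigma(1)<\dots<\sigma(j)$ and $\sigma(j+1)<\dots<\sigma(n)$, and $\chi$ is the graded Koszul sign including the parity of $\sigma$. **Theorem.** For every DFT algebroid, the graded vector space $\mathsf L=\mathsf L_{-1}\oplus\mathsf L_0\oplus\mathsf L_2$ with $\mathsf L_{-1}=C^\infty(\mathcal M)$, $\mathsf L_0=\Gamma(L)$ and $\mathsf L_2=\mathbb R\mu_0$ one-dimensional carries a curved $L_\infty$-algebra structure whose zeroth map is the generator $\mu_0\neq0$ and whose other maps are given on functions $f,f_i$ and sections $e,e_i$ by $$\begin{aligned} \mu_1(f)&=\mathcal Df,\\ \mu_2(e_1,e_2)&=[\![e_1,e_2]\!],\qquad \mu_2(e,f)=\langle e,\mathcal Df\rangle,\\ \mu_3(e_1,e_2,e_3)&=\mathcal N(e_1,e_2,e_3),\\ \mu_3(\mu_0,e,f)&=[\![e,\mathcal Df]\!]-\mathcal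 D\langle e,\mathcal Df\rangle,\\ \mu_3(\mu_0,f_1,f_2)&=2\langle\mathcal Df_1,\mathcal Df_2\rangle,\\ \mu_4(\mu_0,e_1,e_2,e_3)&=\mathcal D\mathcal N(e_1,e_2,e_3)-\mathrm{Jac}(e_1,e_2,e_3),\\ \mu_5(\mu_0,e_1,e_2,e_3,e_4)&=T(e_1,e_2,e_3,e_4)-T(e_1,e_2,e_4,e_3)+T(e_1,e_3,e_4,e_2)-T(e_2,e_3,e_4,e_1), \end{aligned}$$ where $T(e_1,e_2,e_3,e_4)=\tfrac12\langle\mathcal D\mathcal N(e_1,e_2,e_3),e_4\rangle-\tfrac12\langle\mathrm{Jac}(e_1,e_2,e_3),e_4\rangle$; on these elements in any other order the maps are determined by graded antisymmetry, and they vanish on homogeneous elements of all other combinations of degrees. In particular all homotopy Jacobi identities hold exactly, without imposing the strong constraint. -/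

import Mathlib

open Bundle
open scoped Manifold ContDiff Bundle

/-! ### Curved L-infinity algebras -/

namespace LInfty

/-- The sign `χ(σ; l₁, …, lₙ)` for homogeneous elements of degrees `deg i`: each pair of positions
whose order is reversed by `σ` contributes the sign `(-1)^{|l||l'| + 1}` of the transposition of
the two elements, so that `l₁ ∧ ⋯ ∧ lₙ = χ · l_{σ(1)} ∧ ⋯ ∧ l_{σ(n)}` in the graded exterior
algebra. -/
def chi {n : ℕ} (deg : Fin n → ℤ) (σ : Equiv.Perm (Fin n)) : ℤ :=
  ∏ p : Fin n × Fin n,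
    if p.1 < p.2 ∧ σ p.2 < σ p.1 then
      ((deg (σ p.1) * deg (σ p.2) + 1).negOnePow : ℤ) else 1

/-- `σ(1) < ⋯ < σ(j)` and `σ(j+1) < ⋯ < σ(n)`. -/
def IsUnshuffle {n : ℕ} (j : ℕ) (σ : Equiv.Perm (Fin n)) : Prop :=
  (∀ a b : Fin n, a < b → b.val < j → σ a < σ b) ∧
    (∀ a b : Fin n, a < b → j ≤ a.val → σ a < σ b)

section

variable {W : Type*} [AddCommGroup W] [Module ℝ W]

open Classical in
/-- The left-hand side
`∑_{j+k=n} ∑_σ χ(σ;l) (-1)^k μ_{k+1}(μ_j(l_{σ(1)},…,l_{σ(j)}), l_{σ(j+1)},…,l_{σ(n)})`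
of the `n`-th homotopy Jacobi identity, the inner sum being over unshuffles. -/
noncomputable def jacobiator (μ : ∀ n : ℕ, MultilinearMap ℝ (fun _ : Fin n => W) W)
    (n : ℕ) (deg : Fin n → ℤ) (l : Fin n → W) : W :=
  ∑ j : Fin (n + 1), ∑ σ : Equiv.Perm (Fin n),
    if IsUnshuffle j.val σ then
      (chi deg σ * (-1) ^ (n - j.val)) •
        μ (n - j.val + 1) (Fin.cons
          (μ j.val fun a => l (σ ⟨a.val, by omega⟩))
          (fun b : Fin (n - j.val) => l (σ ⟨j.val + b.val, by omega⟩)))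
    else 0

/-- A (possibly curved) `L∞`-algebra on the vector space `W = ⨁ i, 𝒜 i`, in the cohomological
convention: multilinear, graded totally antisymmetric maps `μ n`, `n ≥ 0`, of degree `2 - n`,
satisfying the homotopy Jacobi identities. The curvature is the element `μ 0`. -/
structure CurvedLInftyAlgebra (𝒜 : ℤ → Submodule ℝ W) where
  isInternal : DirectSum.IsInternal 𝒜
  μ : ∀ n : ℕ, MultilinearMap ℝ (fun _ : Fin n => W) W
  degree : ∀ (n : ℕ) (deg : Fin n → ℤ) (l : Fin n → W), (∀ i, l i ∈ 𝒜 (deg i)) →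
    μ n l ∈ 𝒜 ((∑ i, deg i) + 2 - n)
  antisymm : ∀ (n : ℕ) (deg : Fin n → ℤ) (l : Fin n → W), (∀ i, l i ∈ 𝒜 (deg i)) →
    ∀ r s : Fin n, r.val + 1 = s.val →
      μ n l = ((deg r * deg s + 1).negOnePow : ℤ) • μ n (l ∘ Equiv.swap r s)
  homotopyJacobi : ∀ (n : ℕ) (deg : Fin n → ℤ) (l : Fin n → W), (∀ i, l i ∈ 𝒜 (deg i)) →
    jacobiator μ n deg l = 0

end

end LInfty

/-! ### DFT algebroids -/

namespace DFT

/-- The model `ℝ^{2d}` with coordinates `X^A = (x^a, x̃_a)`. -/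
abbrev DoubledSpace (d : ℕ) : Type := (Fin d → ℝ) × (Fin d → ℝ)

/-- `η^{AB} α_A β_B`, where `η^{AB}` is the constant `O(d,d)` matrix with zero diagonal blocks and
identity off-diagonal blocks. -/
def stdCometric {d : ℕ} (α β : DoubledSpace d →L[ℝ] ℝ) : ℝ :=
  ∑ a : Fin d, (α (Pi.single a 1, 0) * β (0, Pi.single a 1) +
    α (0, Pi.single a 1) * β (Pi.single a 1, 0))

section

variable (d : ℕ) (M : Type*) [TopologicalSpace M] [ChartedSpace (DoubledSpace d) M]

/-- The `O(d,d)` pairing of one-forms on the doubled space `M`: around each point there are smooth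
local coordinates `X^A` in which `⟨α_A dX^A, β_B dX^B⟩ = η^{AB} α_A β_B` with the constant matrix
`η^{AB}` above. -/
structure ODDMetric where
  cometric : ∀ x : M, (TangentSpace 𝓘(ℝ, DoubledSpace d) x →L[ℝ] ℝ) →ₗ[ℝ]
    (TangentSpace 𝓘(ℝ, DoubledSpace d) x →L[ℝ] ℝ) →ₗ[ℝ] ℝ
  exists_coordinates : ∀ x₀ : M,
    ∃ φ ∈ IsManifold.maximalAtlas 𝓘(ℝ, DoubledSpace d) ∞ M, x₀ ∈ φ.source ∧
      ∀ x ∈ φ.source, ∀ α β : DoubledSpace d →L[ℝ] ℝ,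
        cometric x (α ∘L mvfderiv 𝓘(ℝ, DoubledSpace d) φ x)
          (β ∘L mvfderiv 𝓘(ℝ, DoubledSpace d) φ x) = stdCometric α β

variable (F : Type*) [NormedAddCommGroup F] [NormedSpace ℝ F]
  (L : M → Type*) [∀ x, AddCommGroup (L x)] [∀ x, Module ℝ (L x)] [∀ x, TopologicalSpace (L x)]
  [TopologicalSpace (TotalSpace F L)] [FiberBundle F L] [VectorBundle ℝ F L]

/-- `C^∞(M)`. -/
abbrev Fn : Type _ := C^∞⟮𝓘(ℝ, DoubledSpace d), M; ℝ⟯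

/-- `Γ(L)`, the smooth sections of `L`. -/
abbrev Sec : Type _ := Cₛ^∞⟮𝓘(ℝ, DoubledSpace d); F, L⟯

/-- The structure maps of a DFT algebroid on the vector bundle `L`: a skew-symmetric bracket of
sections, a smooth nondegenerate symmetric form on the fibres, and a smooth bundle map
`ρ : L → TM`. -/
structure AlgebroidData [IsManifold 𝓘(ℝ, DoubledSpace d) ∞ M] where
  bracket : Sec d M F L →ₗ[ℝ] Sec d M F L →ₗ[ℝ] Sec d M F L
  bracket_skew : ∀ e₁ e₂, bracket e₁ e₂ = -bracket e₂ e₁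
  form : ∀ x : M, L x →L[ℝ] L x →L[ℝ] ℝ
  form_symm : ∀ x v w, form x v w = form x w v
  form_nondegenerate : ∀ x v, (∀ w, form x v w = 0) → v = 0
  form_smooth : ContMDiff 𝓘(ℝ, DoubledSpace d)
    (𝓘(ℝ, DoubledSpace d).prod 𝓘(ℝ, F →L[ℝ] F →L[ℝ] ℝ)) ∞
    (fun x => TotalSpace.mk' (F →L[ℝ] F →L[ℝ] ℝ) (E := fun x => L x →L[ℝ] L x →L[ℝ] ℝ)
      x (form x))
  anchor : ∀ x : M, L x →L[ℝ] TangentSpace 𝓘(ℝ, DoubledSpace d) x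
  anchor_smooth : ContMDiff 𝓘(ℝ, DoubledSpace d)
    (𝓘(ℝ, DoubledSpace d).prod 𝓘(ℝ, F →L[ℝ] DoubledSpace d)) ∞
    (fun x => TotalSpace.mk' (F →L[ℝ] DoubledSpace d)
      (E := fun x => L x →L[ℝ] TangentSpace 𝓘(ℝ, DoubledSpace d) x) x (anchor x))

end

namespace AlgebroidData

variable {d : ℕ} {M : Type*} [TopologicalSpace M] [ChartedSpace (DoubledSpace d) M]
  [IsManifold 𝓘(ℝ, DoubledSpace d) ∞ M]
  {F : Type*} [NormedAddCommGroup F] [NormedSpace ℝ F]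
  {L : M → Type*} [∀ x, AddCommGroup (L x)] [∀ x, Module ℝ (L x)] [∀ x, TopologicalSpace (L x)]
  [TopologicalSpace (TotalSpace F L)] [FiberBundle F L] [VectorBundle ℝ F L]

/-- `⟨e₁, e₂⟩` is a smooth function for smooth sections `e₁`, `e₂`. -/
theorem contMDiff_form_apply (A : AlgebroidData d M F L) (e₁ e₂ : Sec d M F L) :
    ContMDiff 𝓘(ℝ, DoubledSpace d) 𝓘(ℝ, ℝ) ∞ (fun x => A.form x (e₁ x) (e₂ x)) := by
  intro x
  have : ContMDiffAt 𝓘(ℝ, DoubledSpace d) (𝓘(ℝ, DoubledSpace d).prod 𝓘(ℝ)) ∞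
      (fun m ↦ TotalSpace.mk' ℝ (E := Bundle.Trivial M ℝ) m (A.form m (e₁ m) (e₂ m))) x := by
    apply ContMDiffAt.clm_bundle_apply₂ (F₁ := F) (F₂ := F)
    · exact A.form_smooth x
    · exact e₁.contMDiff x
    · exact e₂.contMDiff x
  simp only [contMDiffAt_totalSpace] at this
  exact this.2

/-- The function `⟨e₁, e₂⟩`. -/
noncomputable def inner (A : AlgebroidData d M F L) (e₁ e₂ : Sec d M F L) : Fn d M :=
  ⟨fun x => A.form x (e₁ x) (e₂ x), A.contMDiff_form_apply e₁ e₂⟩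

/-- The one-form `v ↦ ρ(v)f` on the fibres of `L`. -/
noncomputable def anchorDual (A : AlgebroidData d M F L) (f : Fn d M) (x : M) : L x →L[ℝ] ℝ :=
  mvfderiv 𝓘(ℝ, DoubledSpace d) f x ∘L A.anchor x

theorem contMDiff_anchorDual (A : AlgebroidData d M F L) (f : Fn d M) :
    ContMDiff 𝓘(ℝ, DoubledSpace d) (𝓘(ℝ, DoubledSpace d).prod 𝓘(ℝ, F →L[ℝ] ℝ)) ∞
      (fun x => TotalSpace.mk' (F →L[ℝ] ℝ) (E := fun x => L x →L[ℝ] Bundle.Trivial M ℝ x)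
        x (A.anchorDual f x)) := by
  intro x₀
  have h₁ := (f.contMDiff x₀).mfderiv_const (m := ∞) (by simp)
  have h₂ := (contMDiffAt_hom_bundle _).1 (A.anchor_smooth x₀)
  refine (contMDiffAt_hom_bundle _).2 ⟨contMDiffAt_id, ?_⟩
  refine (h₁.clm_comp h₂.2).congr_of_eventuallyEq ?_
  filter_upwards [(trivializationAt F L x₀).open_baseSet.mem_nhds
      (FiberBundle.mem_baseSet_trivializationAt' x₀),
    (trivializationAt (DoubledSpace d) (TangentSpace 𝓘(ℝ, DoubledSpace d))
      x₀).open_baseSet.mem_nhds (FiberBundle.mem_baseSet_trivializationAt' x₀)] with x hx hx'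
  have hf : f x ∈ (trivializationAt ℝ (TangentSpace 𝓘(ℝ, ℝ)) (f x₀)).baseSet := by
    simp only [TangentBundle.trivializationAt_baseSet]
    exact Set.mem_univ _
  ext v
  simp only [inTangentCoordinates, id]
  rw [ContinuousLinearMap.inCoordinates_eq hx hx', ContinuousLinearMap.inCoordinates_eq hx' hf,
    ContinuousLinearMap.inCoordinates_eq hx (Set.mem_univ _)]
  simp [anchorDual, mvfderiv, Trivialization.symm_apply_apply_mk _ hx']
  rfl

/-- The action `ρ(e)f` of a section on a function. -/
noncomputable def act (A : AlgebroidData d M F L) (e : Sec d M F L) (f : Fn d M) : Fn d M where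
  val x := mvfderiv 𝓘(ℝ, DoubledSpace d) f x (A.anchor x (e x))
  property := by
    intro x
    have : ContMDiffAt 𝓘(ℝ, DoubledSpace d) (𝓘(ℝ, DoubledSpace d).prod 𝓘(ℝ)) ∞
        (fun m ↦ TotalSpace.mk' ℝ (E := Bundle.Trivial M ℝ) m (A.anchorDual f m (e m))) x :=
      ContMDiffAt.clm_bundle_apply (A.contMDiff_anchorDual f x) (e.contMDiff x)
    simp only [contMDiffAt_totalSpace] at this
    exact this.2

theorem form_isInvertible [FiniteDimensional ℝ F] [∀ x, IsTopologicalAddGroup (L x)]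
    [∀ x, ContinuousSMul ℝ (L x)] (A : AlgebroidData d M F L) (x : M) :
    (A.form x).IsInvertible := by
  let e : L x ≃L[ℝ] F := (trivializationAt F L x).continuousLinearEquivAt ℝ x
    (FiberBundle.mem_baseSet_trivializationAt' x)
  let B : F →ₗ[ℝ] (F →L[ℝ] ℝ) :=
    ((e.symm.arrowCongr (ContinuousLinearEquiv.refl ℝ ℝ)).symm.toContinuousLinearMap ∘L
      A.form x ∘L e.symm.toContinuousLinearMap).toLinearMap
  have hB : Function.Injective B := by
    rw [injective_iff_map_eq_zero]
    intro v hv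
    have : e.symm v = 0 := A.form_nondegenerate x _ fun w => by
      have := congrArg (fun g : F →L[ℝ] ℝ => g (e w)) hv
      simpa [B] using this
    simpa using this
  have hd : Module.finrank ℝ F = Module.finrank ℝ (F →L[ℝ] ℝ) := by
    rw [← (LinearMap.toContinuousLinearMap (𝕜 := ℝ) (E := F) (F' := ℝ)).finrank_eq]
    exact (Subspace.dual_finrank_eq).symm
  let B' : F ≃L[ℝ] (F →L[ℝ] ℝ) :=
    (LinearEquiv.ofInjectiveOfFinrankEq B hB hd).toContinuousLinearEquiv
  refine ⟨(e.trans B').trans (e.symm.arrowCongr (ContinuousLinearEquiv.refl ℝ ℝ)), ?_⟩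
  have hB' : ∀ v, B' v = B v := fun _ => rfl
  ext v w
  simp [hB', B]

/-- `𝓓f`, characterized by `⟨𝓓f, e⟩ = ½ ρ(e)f`: the one-form `½ ρ(·)f` on `L` transported by the
inverse of the nondegenerate form. -/
noncomputable def D [FiniteDimensional ℝ F] [∀ x, IsTopologicalAddGroup (L x)]
    [∀ x, ContinuousSMul ℝ (L x)] [ContMDiffVectorBundle ∞ F L 𝓘(ℝ, DoubledSpace d)]
    (A : AlgebroidData d M F L) (f : Fn d M) : Sec d M F L where
  toFun x := (A.form x).inverse ((1 / 2 : ℝ) • A.anchorDual f x)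
  contMDiff_toFun := by
    intro x₀
    have hb := FiberBundle.mem_baseSet_trivializationAt' (F := F) (E := L) x₀
    have hb' := FiberBundle.mem_baseSet_trivializationAt' (F := F →L[ℝ] ℝ)
      (E := fun x => L x →L[ℝ] Bundle.Trivial M ℝ x) x₀
    have h₁ := (contMDiffAt_hom_bundle _).1 (A.form_smooth x₀)
    have h₂ : ContMDiffAt 𝓘(ℝ, DoubledSpace d) 𝓘(ℝ, (F →L[ℝ] ℝ) →L[ℝ] F) ∞
        (ContinuousLinearMap.inverse ∘ fun x => ContinuousLinearMap.inCoordinates F L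
          (F →L[ℝ] ℝ) (fun x => L x →L[ℝ] Bundle.Trivial M ℝ x) x₀ x x₀ x (A.form x)) x₀ := by
      refine ContMDiffAt.comp _ (ContDiffAt.contMDiffAt ?_) h₁.2
      apply ContinuousLinearMap.IsInvertible.contDiffAt_map_inverse
      rw [ContinuousLinearMap.inCoordinates_eq hb hb']
      exact ContinuousLinearMap.isInvertible_equiv.comp
        ((A.form_isInvertible x₀).comp ContinuousLinearMap.isInvertible_equiv)
    refine ContMDiffAt.clm_apply_of_inCoordinates (F₁ := F →L[ℝ] ℝ)
      (E₁ := fun x => L x →L[ℝ] Bundle.Trivial M ℝ x) (b₁ := id) (b₂ := id)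
      (h₂.congr_of_eventuallyEq ?_) ((A.contMDiff_anchorDual f).const_smul_section x₀)
      contMDiffAt_id
    filter_upwards [(trivializationAt F L x₀).open_baseSet.mem_nhds hb,
      (trivializationAt (F →L[ℝ] ℝ)
        (fun x => L x →L[ℝ] Bundle.Trivial M ℝ x) x₀).open_baseSet.mem_nhds hb'] with x hx hx'
    simp only [Function.comp_apply, id]
    rw [ContinuousLinearMap.inCoordinates_eq hx hx', ContinuousLinearMap.inCoordinates_eq hx' hx]
    simp only [ContinuousLinearMap.inverse_equiv_comp, ContinuousLinearMap.inverse_comp_equiv,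
      ContinuousLinearEquiv.symm_symm]
    rfl

theorem form_D [FiniteDimensional ℝ F] [∀ x, IsTopologicalAddGroup (L x)]
    [∀ x, ContinuousSMul ℝ (L x)] [ContMDiffVectorBundle ∞ F L 𝓘(ℝ, DoubledSpace d)]
    (A : AlgebroidData d M F L) (f : Fn d M) (e : Sec d M F L) :
    A.inner (A.D f) e = (1 / 2 : ℝ) • A.act e f := by
  ext x
  have h := A.form_isInvertible x
  change A.form x ((A.form x).inverse ((1 / 2 : ℝ) • A.anchorDual f x)) (e x) = _
  rw [← ContinuousLinearMap.comp_apply, h.self_comp_inverse]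
  rfl

/-- The product `f e` of a function and a section. -/
noncomputable def smulSec (f : Fn d M) (e : Sec d M F L) : Sec d M F L :=
  ⟨fun x => f x • e x, f.contMDiff.smul_section e.contMDiff⟩

end AlgebroidData

section

variable {d : ℕ} {M : Type*} [TopologicalSpace M] [ChartedSpace (DoubledSpace d) M]
  [IsManifold 𝓘(ℝ, DoubledSpace d) ∞ M]

/-- A DFT algebroid on the vector bundle `L` over the doubled space `(M, η)`. -/
structure DFTAlgebroid (η : ODDMetric d M)
    (F : Type*) [NormedAddCommGroup F] [NormedSpace ℝ F] [FiniteDimensional ℝ F]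
    (L : M → Type*) [∀ x, AddCommGroup (L x)] [∀ x, Module ℝ (L x)]
    [∀ x, TopologicalSpace (L x)] [∀ x, IsTopologicalAddGroup (L x)]
    [∀ x, ContinuousSMul ℝ (L x)] [TopologicalSpace (TotalSpace F L)] [FiberBundle F L]
    [VectorBundle ℝ F L] [ContMDiffVectorBundle ∞ F L 𝓘(ℝ, DoubledSpace d)]
    extends AlgebroidData d M F L where
  /-- `⟨𝓓f, 𝓓g⟩ = ¼ ⟨df, dg⟩`. -/
  inner_D_D : ∀ (f g : Fn d M) (x : M),
    toAlgebroidData.inner (toAlgebroidData.D f) (toAlgebroidData.D g) x =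
      1 / 4 * η.cometric x (mvfderiv 𝓘(ℝ, DoubledSpace d) f x)
        (mvfderiv 𝓘(ℝ, DoubledSpace d) g x)
  /-- `[e₁, f e₂] = f [e₁, e₂] + (ρ(e₁)f) e₂ - ⟨e₁, e₂⟩ 𝓓f`. -/
  leibniz : ∀ (e₁ e₂ : Sec d M F L) (f : Fn d M),
    bracket e₁ (AlgebroidData.smulSec f e₂) =
      AlgebroidData.smulSec f (bracket e₁ e₂) +
        AlgebroidData.smulSec (toAlgebroidData.act e₁ f) e₂ -
        AlgebroidData.smulSec (toAlgebroidData.inner e₁ e₂) (toAlgebroidData.D f)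
  /-- `⟨[e₃, e₁] + 𝓓⟨e₃, e₁⟩, e₂⟩ + ⟨e₁, [e₃, e₂] + 𝓓⟨e₃, e₂⟩⟩ = ρ(e₃)⟨e₁, e₂⟩`. -/
  compat : ∀ e₁ e₂ e₃ : Sec d M F L,
    toAlgebroidData.inner
        (bracket e₃ e₁ + toAlgebroidData.D (toAlgebroidData.inner e₃ e₁)) e₂ +
      toAlgebroidData.inner e₁
        (bracket e₃ e₂ + toAlgebroidData.D (toAlgebroidData.inner e₃ e₂)) =
      toAlgebroidData.act e₃ (toAlgebroidData.inner e₁ e₂)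

end

section

variable (d : ℕ) (M : Type*) [TopologicalSpace M] [ChartedSpace (DoubledSpace d) M]
  (F : Type*) [NormedAddCommGroup F] [NormedSpace ℝ F]
  (L : M → Type*) [∀ x, AddCommGroup (L x)] [∀ x, Module ℝ (L x)] [∀ x, TopologicalSpace (L x)]
  [TopologicalSpace (TotalSpace F L)] [FiberBundle F L] [VectorBundle ℝ F L]

/-- The total space `L_{-1} ⊕ L_0 ⊕ L_2 = C^∞(M) ⊕ Γ(L) ⊕ ℝ μ₀`. -/
abbrev Total : Type _ := Fn d M × Sec d M F L × ℝ

/-- The grading of `Total`: functions have degree `-1`, sections degree `0`, the line spanned by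
`μ₀` degree `2`, and all other homogeneous components vanish. -/
noncomputable def grading (i : ℤ) : Submodule ℝ (Total d M F L) where
  carrier := {w | (i ≠ -1 → w.1 = 0) ∧ (i ≠ 0 → w.2.1 = 0) ∧ (i ≠ 2 → w.2.2 = 0)}
  zero_mem' := ⟨fun _ => rfl, fun _ => rfl, fun _ => rfl⟩
  add_mem' := fun {a b} ha hb =>
    ⟨fun h => by rw [Prod.fst_add, ha.1 h, hb.1 h, add_zero],
      fun h => by rw [Prod.snd_add, Prod.fst_add, ha.2.1 h, hb.2.1 h, add_zero],
      fun h => by rw [Prod.snd_add, Prod.snd_add, ha.2.2 h, hb.2.2 h, add_zero]⟩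
  smul_mem' := fun c a ha =>
    ⟨fun h => by rw [Prod.smul_fst, ha.1 h, smul_zero],
      fun h => by rw [Prod.smul_snd, Prod.smul_fst, ha.2.1 h, smul_zero],
      fun h => by rw [Prod.smul_snd, Prod.smul_snd, ha.2.2 h, smul_zero]⟩

variable {d M F L}

/-- A function, as an element of degree `-1`. -/
noncomputable def ofFn (f : Fn d M) : Total d M F L := (f, 0, 0)

/-- A section, as an element of degree `0`. -/
noncomputable def ofSec (e : Sec d M F L) : Total d M F L := (0, e, 0)

variable (d M F L) in
/-- The constant element `μ₀`, the generator of the degree `2` part. -/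
noncomputable def mu₀ : Total d M F L := (0, 0, 1)

end

namespace DFTAlgebroid

variable {d : ℕ} {M : Type*} [TopologicalSpace M] [ChartedSpace (DoubledSpace d) M]
  [IsManifold 𝓘(ℝ, DoubledSpace d) ∞ M] {η : ODDMetric d M}
  {F : Type*} [NormedAddCommGroup F] [NormedSpace ℝ F] [FiniteDimensional ℝ F]
  {L : M → Type*} [∀ x, AddCommGroup (L x)] [∀ x, Module ℝ (L x)]
  [∀ x, TopologicalSpace (L x)] [∀ x, IsTopologicalAddGroup (L x)]
  [∀ x, ContinuousSMul ℝ (L x)] [TopologicalSpace (TotalSpace F L)] [FiberBundle F L]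
  [VectorBundle ℝ F L] [ContMDiffVectorBundle ∞ F L 𝓘(ℝ, DoubledSpace d)]

/-- `𝓝(e₁, e₂, e₃) = ⅓ ⟨[e₁, e₂], e₃⟩ + cyclic`. -/
noncomputable def N (A : DFTAlgebroid η F L) (e₁ e₂ e₃ : Sec d M F L) : Fn d M :=
  (1 / 3 : ℝ) • (A.inner (A.bracket e₁ e₂) e₃ + A.inner (A.bracket e₂ e₃) e₁ +
    A.inner (A.bracket e₃ e₁) e₂)

/-- `Jac(e₁, e₂, e₃) = [[e₁, e₂], e₃] + cyclic`. -/
noncomputable def Jac (A : DFTAlgebroid η F L) (e₁ e₂ e₃ : Sec d M F L) : Sec d M F L :=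
  A.bracket (A.bracket e₁ e₂) e₃ + A.bracket (A.bracket e₂ e₃) e₁ +
    A.bracket (A.bracket e₃ e₁) e₂

/-- `½ ⟨𝓓𝓝(e₁, e₂, e₃), e₄⟩ - ½ ⟨Jac(e₁, e₂, e₃), e₄⟩`. -/
noncomputable def quart (A : DFTAlgebroid η F L) (e₁ e₂ e₃ e₄ : Sec d M F L) : Fn d M :=
  (1 / 2 : ℝ) • A.inner (A.D (A.N e₁ e₂ e₃)) e₄ - (1 / 2 : ℝ) • A.inner (A.Jac e₁ e₂ e₃) e₄

/-- The multilinear maps `μ` on `Total` are those of the DFT algebroid `A`: they have the listed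
values, and vanish on homogeneous elements of all other combinations of degrees. (Values on the
listed elements in any other order are determined by graded antisymmetry.) -/
structure HasMaps (A : DFTAlgebroid η F L)
    (μ : ∀ n : ℕ, MultilinearMap ℝ (fun _ : Fin n => Total d M F L) (Total d M F L)) : Prop where
  curvature : μ 0 ![] = mu₀ d M F L
  map_f : ∀ f, μ 1 ![ofFn f] = ofSec (A.D f)
  map_ee : ∀ e₁ e₂, μ 2 ![ofSec e₁, ofSec e₂] = ofSec (A.bracket e₁ e₂)
  map_ef : ∀ e f, μ 2 ![ofSec e, ofFn f] = ofFn (A.inner e (A.D f))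
  map_eee : ∀ e₁ e₂ e₃, μ 3 ![ofSec e₁, ofSec e₂, ofSec e₃] = ofFn (A.N e₁ e₂ e₃)
  map_mu₀_ef : ∀ e f, μ 3 ![mu₀ d M F L, ofSec e, ofFn f] =
    ofSec (A.bracket e (A.D f) - A.D (A.inner e (A.D f)))
  map_mu₀_ff : ∀ f₁ f₂, μ 3 ![mu₀ d M F L, ofFn f₁, ofFn f₂] =
    ofFn ((2 : ℝ) • A.inner (A.D f₁) (A.D f₂))
  map_mu₀_eee : ∀ e₁ e₂ e₃, μ 4 ![mu₀ d M F L, ofSec e₁, ofSec e₂, ofSec e₃] =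
    ofSec (A.D (A.N e₁ e₂ e₃) - A.Jac e₁ e₂ e₃)
  /-- The sum over the four terms of the antisymmetrization; `quart` is already antisymmetric in
  its first three arguments. -/
  map_mu₀_eeee : ∀ e₁ e₂ e₃ e₄,
    μ 5 ![mu₀ d M F L, ofSec e₁, ofSec e₂, ofSec e₃, ofSec e₄] =
      ofFn (A.quart e₁ e₂ e₃ e₄ - A.quart e₁ e₂ e₄ e₃ + A.quart e₁ e₃ e₄ e₂ -
        A.quart e₂ e₃ e₄ e₁)
  map_other : ∀ (n : ℕ) (deg : Fin n → ℤ) (l : Fin n → Total d M F L),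
    (∀ i, l i ∈ grading d M F L (deg i)) →
    Finset.univ.val.map deg ∉ ({0, {-1}, {0, 0}, {0, -1}, {0, 0, 0}, {2, 0, -1}, {2, -1, -1},
      {2, 0, 0, 0}, {2, 0, 0, 0, 0}} : Set (Multiset ℤ)) →
    μ n l = 0

end DFTAlgebroid

end DFT

/-! The theorem is purely algebraic. Since ρ(e)f = 2⟨Df, e⟩, axiom 3 is an identity between the
bracket, the pairing and D. `MetricBracket` keeps this identity, skewness of the bracket and
symmetry of the pairing, over abstract real vector spaces V and E, and everything is derived from
these.

Metric compatibility fixes the bracket up to the totally antisymmetric N (`inner_br`): ⟨[a,b],c⟩ =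
N(a,b,c) + ⟨a, D⟨b,c⟩⟩ - ⟨b, D⟨a,c⟩⟩. Two substantive identities result: `N_D`, which is the
homotopy Jacobi identity on two sections and a function, and `P_eq`, which is the one on four
sections. The other identities without a curvature argument say that the maps involving μ₀ are
exactly the defects K, Q and 2⟨Df, Dg⟩. The identities with one curvature argument are consistency
conditions between these defects; they are checked by expansion with `N_D` and `P_eq`, and once with
compatibility itself.

Only finitely many checks are needed. The identity on n arguments takes values in degree (sum of
degrees) + 3 - n, and only the degrees -1, 0, 2 are nonzero; with at most one curvature argument
this leaves fourteen types of arguments (`J_sorted`). With two curvature arguments the summands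
cancel in pairs (`J_curv_curv`). Graded antisymmetry lets the arguments be sorted first
(`exists_splitSum_perm`).

To make the checks computable, the sum over unshuffles is turned into a recursion over splittings of
a list (`sum_isUnshuffle_eq_splitSum`), which `simp` can unfold on explicit arguments. -/

namespace LInfty

/-! ### Sums over unshuffles as sums over splittings of a list -/

section Splits

variable {X Y : Type*} [AddCommGroup Y] (dg : X → ℤ)

/-- The sign of the transposition of two neighbouring homogeneous elements. -/
def swapSign (x y : X) : ℤ := ((dg y * dg x + 1).negOnePow : ℤ)

theorem swapSign_comm (x y : X) : swapSign dg x y = swapSign dg y x := by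
  simp only [swapSign, mul_comm]

theorem swapSign_mul_self (x y : X) : swapSign dg x y * swapSign dg x y = 1 := by
  simp only [swapSign, ← Units.val_mul, Int.units_mul_self, Units.val_one]

/-- The sign of moving `x` past all elements of `A`. -/
def passSign (x : X) (A : List X) : ℤ := (A.map (swapSign dg x)).prod

/-- The signed sum of `G A B` over all ways to split a list into two complementary sublists. -/
def splitSum (G : List X → List X → Y) : List X → Y
  | [] => G [] []
  | x :: L => splitSum (fun A B => G (x :: A) B) L +
      splitSum (fun A B => passSign dg x A • G A (x :: B)) L

/-- `G` is graded antisymmetric in both of its lists of arguments. -/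
def SplitAntisymm (G : List X → List X → Y) : Prop :=
  (∀ A₁ x y A₂ B, G (A₁ ++ x :: y :: A₂) B = swapSign dg x y • G (A₁ ++ y :: x :: A₂) B) ∧
    ∀ A B₁ x y B₂, G A (B₁ ++ x :: y :: B₂) = swapSign dg x y • G A (B₁ ++ y :: x :: B₂)

variable {dg}

theorem splitSum_smul (c : ℤ) (G : List X → List X → Y) (L : List X) :
    splitSum dg (fun A B => c • G A B) L = c • splitSum dg G L := by
  induction L generalizing G with
  | nil => rfl
  | cons x L ih =>
    simp only [splitSum, smul_add, ← ih]
    simp only [smul_comm c]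

theorem splitSum_mem (p : AddSubgroup Y) (G : List X → List X → Y) (L : List X)
    (h : ∀ A B, (A ++ B).Perm L → G A B ∈ p) : splitSum dg G L ∈ p := by
  induction L generalizing G with
  | nil => exact h [] [] (List.Perm.refl _)
  | cons x L ih =>
    refine p.add_mem (ih _ fun A B hAB => h _ _ (hAB.cons x)) (ih _ fun A B hAB => ?_)
    exact p.zsmul_mem (h _ _ (List.perm_middle.trans (hAB.cons x))) _

theorem SplitAntisymm.consLeft {G : List X → List X → Y} (hG : SplitAntisymm dg G) (x : X) :
    SplitAntisymm dg fun A B => G (x :: A) B :=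
  ⟨fun A₁ => hG.1 (x :: A₁), fun A => hG.2 (x :: A)⟩

theorem SplitAntisymm.consRight {G : List X → List X → Y} (hG : SplitAntisymm dg G) (x : X) :
    SplitAntisymm dg fun A B => passSign dg x A • G A (x :: B) := by
  refine ⟨fun A₁ y z A₂ B => ?_, fun A B₁ y z B₂ => ?_⟩
  -- The passing sign is a product over the list, so it ignores the order.
  · have : passSign dg x (A₁ ++ y :: z :: A₂) = passSign dg x (A₁ ++ z :: y :: A₂) := by
      simp only [passSign, List.map_append, List.map_cons, List.prod_append, List.prod_cons]
      ring
    simp only [this, hG.1 A₁ y z A₂, smul_comm (swapSign dg y z)]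
  · have := hG.2 A (x :: B₁) y z B₂
    simp only [List.cons_append] at this
    simp only [this, smul_comm (swapSign dg y z)]

/-- Of the four ways to place x and y, those with both in the same block acquire the sign by
antisymmetry of G. The two mixed placements are exchanged, and there the sign comes from `passSign`,
which counts the pair x, y in exactly one of the two orders. -/
theorem splitSum_swap {G : List X → List X → Y} (hG : SplitAntisymm dg G) (x y : X)
    (L : List X) : splitSum dg G (x :: y :: L) = swapSign dg x y • splitSum dg G (y :: x :: L) := by
  simp only [splitSum, smul_add, ← splitSum_smul]
  have h₁ := fun A B => hG.1 [] x y A B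
  have h₂ := fun A B => hG.2 A [] x y B
  simp only [List.nil_append] at h₁ h₂
  simp only [h₁, h₂, passSign, List.map_cons, List.prod_cons, smul_smul]
  have e₁ : ∀ A : List X, (A.map (swapSign dg y)).prod =
      swapSign dg x y * (swapSign dg y x * (A.map (swapSign dg y)).prod) := fun A => by
    rw [swapSign_comm dg y x, ← mul_assoc, swapSign_mul_self, one_mul]
  have e₂ : ∀ A : List X, (A.map (swapSign dg y)).prod * ((A.map (swapSign dg x)).prod *
      swapSign dg x y) = swapSign dg x y *
      ((A.map (swapSign dg x)).prod * (A.map (swapSign dg y)).prod) := fun A => by ring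
  simp only [e₂, ← e₁]
  abel

/-- The sign is chosen before G because the `cons` step applies the induction hypothesis to two
different G, which must pick up the same sign. -/
theorem exists_splitSum_perm {L L' : List X} (h : L.Perm L') :
    ∃ s : ℤ, ∀ G : List X → List X → Y, SplitAntisymm dg G →
      splitSum dg G L = s • splitSum dg G L' := by
  induction h with
  | nil => exact ⟨1, fun G _ => by simp⟩
  | @cons x L L' _ ih =>
    obtain ⟨s, hs⟩ := ih
    exact ⟨s, fun G hG => by
      simp only [splitSum, hs _ (hG.consLeft x), hs _ (hG.consRight x), smul_add]⟩
  | swap x y L => exact ⟨swapSign dg y x, fun G hG => splitSum_swap hG y x L⟩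
  | trans _ _ ih₁ ih₂ =>
    obtain ⟨s, hs⟩ := ih₁
    obtain ⟨t, ht⟩ := ih₂
    exact ⟨s * t, fun G hG => by rw [hs G hG, ht G hG, smul_smul]⟩

end Splits

/-! ### Recursion for unshuffles on the position of the smallest index. -/

section Unshuffles

/-- The permutation `σ` with `σ k = 0` that agrees with `σ'` on the other positions. -/
def insertPerm {n : ℕ} (k : Fin (n + 1)) (σ' : Equiv.Perm (Fin n)) : Equiv.Perm (Fin (n + 1)) :=
  ((finSuccEquiv' k).trans σ'.optionCongr).trans (finSuccEquiv' 0).symm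

@[simp] theorem insertPerm_self {n : ℕ} (k : Fin (n + 1)) (σ' : Equiv.Perm (Fin n)) :
    insertPerm k σ' k = 0 := by simp [insertPerm]

@[simp] theorem insertPerm_succAbove {n : ℕ} (k : Fin (n + 1)) (σ' : Equiv.Perm (Fin n))
    (i : Fin n) : insertPerm k σ' (k.succAbove i) = (σ' i).succ := by simp [insertPerm]

/-- k is recovered as the preimage of 0, and the cardinalities agree since (n+1)! = (n+1) · n!. -/
theorem insertPerm_bijective (n : ℕ) :
    Function.Bijective fun p : Fin (n + 1) × Equiv.Perm (Fin n) => insertPerm p.1 p.2 := by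
  rw [Fintype.bijective_iff_injective_and_card]
  refine ⟨?_, by simp [Fintype.card_perm, Nat.factorial_succ]⟩
  rintro ⟨k, σ⟩ ⟨k', σ'⟩ h
  simp only at h
  have hk : k = k' := (insertPerm k' σ').injective (by rw [← h, insertPerm_self, h, insertPerm_self])
  subst hk
  congr 1
  ext i
  have := congrArg (fun τ : Equiv.Perm (Fin (n + 1)) => τ (k.succAbove i)) h
  simpa [Fin.ext_iff] using this

theorem val_succAbove {n : ℕ} (k : Fin (n + 1)) (i : Fin n) :
    (k.succAbove i).val = if i.val < k.val then i.val else i.val + 1 := by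
  simp only [Fin.succAbove, Fin.lt_def, Fin.val_castSucc]
  split_ifs <;> rfl

/-- The value 0 at position k forms an inversion with precisely the entries to its left; all other
inversions are those of σ'. -/
theorem chi_insertPerm {n : ℕ} (deg : Fin (n + 1) → ℤ) (k : Fin (n + 1))
    (σ' : Equiv.Perm (Fin n)) :
    chi deg (insertPerm k σ') =
      (∏ i with i.val < k.val, ((deg (σ' i).succ * deg 0 + 1).negOnePow : ℤ)) *
        chi (fun i => deg i.succ) σ' := by
  simp only [chi, Fintype.prod_prod_type]
  rw [Fin.prod_univ_succAbove _ k]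
  simp only [Fin.prod_univ_succAbove _ k]
  simp only [insertPerm_self, insertPerm_succAbove, Fin.not_lt_zero, and_false, if_false,
    Finset.prod_const_one, one_mul, Fin.succ_pos, and_true, Finset.prod_mul_distrib,
    Fin.succ_lt_succ_iff, (Fin.strictMono_succAbove k).lt_iff_lt, Finset.prod_filter]
  congr 1
  refine Finset.prod_congr rfl fun i _ => ?_
  have : k.succAbove i < k ↔ i.val < k.val := by
    rw [Fin.lt_def, val_succAbove]
    split_ifs <;> omega
  simp only [this]

/-- The smallest value must open its block: it sits at position j, where the second block begins, or
at position 0 with a nonempty first block, which then shrinks by one on removal. The condition 0 < j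
makes the two cases exclusive. -/
theorem isUnshuffle_insertPerm {n : ℕ} (j : ℕ) (k : Fin (n + 1)) (σ' : Equiv.Perm (Fin n)) :
    IsUnshuffle j (insertPerm k σ') ↔ (k.val = j ∧ IsUnshuffle j σ') ∨
      (k.val = 0 ∧ 0 < j ∧ IsUnshuffle (j - 1) σ') := by
  have hmono : ∀ a b : Fin n, k.succAbove a < k.succAbove b ↔ a < b := fun a b =>
    (Fin.strictMono_succAbove k).lt_iff_lt
  have hk : ∀ a : Fin n, k.succAbove a < k ↔ a.val < k.val := fun a => by
    rw [Fin.lt_def, val_succAbove]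
    split_ifs <;> omega
  simp only [IsUnshuffle, Fin.forall_iff_succAbove k, insertPerm_self, insertPerm_succAbove,
    Fin.succ_lt_succ_iff, hmono, Fin.succ_pos, Fin.not_lt_zero, hk, lt_self_iff_false,
    implies_true, true_and, false_imp_iff, val_succAbove, imp_false]
  constructor
  · rintro ⟨h₁, h₂⟩
    -- Otherwise position k - 1 lies in the same block as k and carries a larger value.
    have hcases : k.val = 0 ∨ k.val = j := by
      by_contra! hne
      have hkn := k.isLt
      have ha := h₁ ⟨k.val - 1, by omega⟩
      have hb := h₂ ⟨k.val - 1, by omega⟩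
      simp only at ha hb
      have hlt : k.val - 1 < k.val := by omega
      have ha' := ha.1 hlt
      have hb' := hb.1 hlt
      rw [if_pos hlt] at hb'
      omega
    by_cases hkj : k.val = j
    · refine Or.inl ⟨hkj, fun a b hab hb => (h₁ a).2 b hab ?_, fun a b hab ha => (h₂ a).2 b hab ?_⟩
      · rw [if_pos (by omega)]; exact hb
      · rw [if_neg (by omega)]; omega
    · refine Or.inr ⟨by omega, by omega, fun a b hab hb => (h₁ a).2 b hab ?_,
        fun a b hab ha => (h₂ a).2 b hab ?_⟩
      · rw [if_neg (by omega)]; omega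
      · rw [if_neg (by omega)]; omega
  · rintro (⟨hkj, h₁, h₂⟩ | ⟨hk0, hj, h₁, h₂⟩)
    · refine ⟨fun a => ⟨fun h => by omega, fun b hab hb => h₁ a b hab ?_⟩,
        fun a => ⟨fun h => by rw [if_pos h]; omega, fun b hab ha => h₂ a b hab ?_⟩⟩
      · split_ifs at hb <;> omega
      · split_ifs at ha <;> omega
    · refine ⟨fun a => ⟨fun h => by omega, fun b hab hb => h₁ a b hab ?_⟩,
        fun a => ⟨fun h => by omega, fun b hab ha => h₂ a b hab ?_⟩⟩
      · rw [if_neg (by omega)] at hb; omega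
      · rw [if_neg (by omega)] at ha; omega

variable {X Y : Type*} [AddCommGroup Y] (dg : X → ℤ)

theorem ofFn_insertPerm {n : ℕ} (k : Fin (n + 1)) (σ' : Equiv.Perm (Fin n))
    (x : Fin (n + 1) → X) : List.ofFn (fun i => x (insertPerm k σ' i)) =
      (List.ofFn fun i => x (σ' i).succ).take k ++
        x 0 :: (List.ofFn fun i => x (σ' i).succ).drop k := by
  have hkn := k.isLt
  refine List.ext_getElem (by simp; omega) fun m h₁ h₂ => ?_
  rw [List.length_ofFn] at h₁
  rw [List.getElem_ofFn]
  rcases Fin.eq_self_or_eq_succAbove k ⟨m, h₁⟩ with h | ⟨i, h⟩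
  · have hm : m = k.val := congrArg Fin.val h
    rw [h, insertPerm_self]
    subst hm
    rw [List.getElem_append_right (by simp)]
    simp [Nat.min_eq_left (show k.val ≤ n by omega)]
  · have hm : m = _ := congrArg Fin.val h
    rw [val_succAbove] at hm
    rw [h, insertPerm_succAbove]
    split_ifs at hm with hik
    · subst hm
      rw [List.getElem_append_left (by simp [hik])]
      simp
    · subst hm
      rw [List.getElem_append_right (by simp; omega)]
      have : i.val + 1 - min k.val n = i.val - k.val + 1 := by omega
      simp only [List.length_take, List.length_ofFn, this, List.getElem_cons_succ,
        List.getElem_drop, List.getElem_ofFn]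
      congr 3
      ext
      simp only
      omega

open Classical in
/-- The signed sum over unshuffles is the signed sum over splittings. -/
theorem sum_isUnshuffle_eq_splitSum {n : ℕ} (x : Fin n → X) (G : List X → List X → Y) :
    ∑ j : Fin (n + 1), ∑ σ : Equiv.Perm (Fin n),
      (if IsUnshuffle j.val σ then chi (fun i => dg (x i)) σ •
        G ((List.ofFn fun i => x (σ i)).take j.val) ((List.ofFn fun i => x (σ i)).drop j.val)
      else 0) = splitSum dg G (List.ofFn x) := by
  induction n generalizing G with
  | zero =>
    simp [splitSum, IsUnshuffle, chi]
  | succ n ih =>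
    have key : ∀ j : Fin (n + 2), ∑ σ : Equiv.Perm (Fin (n + 1)),
        (if IsUnshuffle j.val σ then chi (fun i => dg (x i)) σ •
          G ((List.ofFn fun i => x (σ i)).take j.val) ((List.ofFn fun i => x (σ i)).drop j.val)
        else 0) =
        ∑ k : Fin (n + 1), ∑ σ' : Equiv.Perm (Fin n),
          ((if k.val = j.val ∧ IsUnshuffle j.val σ' then
            chi (fun i => dg (x i)) (insertPerm k σ') •
            G ((List.ofFn fun i => x (insertPerm k σ' i)).take j.val)
              ((List.ofFn fun i => x (insertPerm k σ' i)).drop j.val) else 0) +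
          if k.val = 0 ∧ 0 < j.val ∧ IsUnshuffle (j.val - 1) σ' then
            chi (fun i => dg (x i)) (insertPerm k σ') •
            G ((List.ofFn fun i => x (insertPerm k σ' i)).take j.val)
              ((List.ofFn fun i => x (insertPerm k σ' i)).drop j.val) else 0) := fun j => by
      rw [← (insertPerm_bijective n).sum_comp, Fintype.sum_prod_type]
      refine Finset.sum_congr rfl fun k _ => Finset.sum_congr rfl fun σ' _ => ?_
      simp only [isUnshuffle_insertPerm]
      by_cases h₁ : k.val = j.val ∧ IsUnshuffle j.val σ'
      · rw [if_pos (Or.inl h₁), if_pos h₁, if_neg (fun h => by omega), add_zero]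
      · simp only [h₁, false_or, if_false, zero_add]
    simp only [key, Finset.sum_add_distrib, List.ofFn_succ (f := x), splitSum]
    -- The terms k = 0 put the first element into the left block, which `splitSum` lists first.
    rw [add_comm]
    congr 1
    -- For j = 0 there is no left block to receive the element; the other j drop by one.
    · rw [Fin.sum_univ_succ]
      simp only [Fin.val_zero, lt_self_iff_false, false_and, and_false, if_false,
        Finset.sum_const_zero, zero_add, Fin.val_succ, Nat.succ_pos, true_and, Nat.add_sub_cancel]
      rw [← ih]
      refine Finset.sum_congr rfl fun j _ => ?_
      rw [Finset.sum_eq_single 0 (fun k _ hk => ?_) (by simp)]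
      · refine Finset.sum_congr rfl fun σ' _ => ?_
        rw [ofFn_insertPerm, chi_insertPerm]
        simp
      · simp [Fin.val_ne_zero_iff.2 hk]
    -- For j = n + 1 there is no right block, so k = j is impossible.
    · rw [Fin.sum_univ_castSucc]
      simp only [Fin.val_castSucc, Fin.val_last]
      have hlast : ∀ k : Fin (n + 1), ¬k.val = n + 1 := fun k => k.isLt.ne
      simp only [hlast, false_and, if_false, Finset.sum_const_zero, add_zero]
      rw [← ih]
      refine Finset.sum_congr rfl fun j _ => ?_
      rw [Finset.sum_eq_single j (fun k _ hk => ?_) (by simp)]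
      · refine Finset.sum_congr rfl fun σ' _ => ?_
        simp only [true_and]
        rw [ofFn_insertPerm, chi_insertPerm, List.take_append_of_le_length (by simp; omega),
          List.drop_append_of_le_length (by simp; omega)]
        simp only [passSign, List.map_take, List.map_ofFn, List.prod_take_ofFn, swapSign,
          Function.comp_def, List.take_take, min_self, mul_smul, smul_comm (chi _ _)]
        have : ((List.ofFn fun i => x (σ' i).succ).take j.val).drop j.val = [] := by simp
        rw [this, List.nil_append]
      · simp [Fin.val_ne_iff.2 hk]

end Unshuffles

/-! ### Multilinear maps evaluated on lists -/

section ListEval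

variable {W X : Type*} [AddCommGroup W] [Module ℝ W]
  (μ : ∀ n : ℕ, MultilinearMap ℝ (fun _ : Fin n => W) W)

/-- The value of the family `μ` on a list of arguments. -/
def listEval (L : List W) : W := μ L.length L.get

/-- Confines the dependence of the arity on the list to one place: substituting the length makes the
index casts trivial. -/
theorem listEval_of_length {n : ℕ} (L : List W) (h : L.length = n) :
    listEval μ L = μ n fun i => L.get (i.cast h.symm) := by
  subst h; rfl

theorem listEval_ofFn {n : ℕ} (v : Fin n → W) : listEval μ (List.ofFn v) = μ n v := by
  rw [listEval_of_length μ _ (List.length_ofFn (f := v))]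
  congr 1
  ext i
  simp

theorem listEval_smul_cons (c : ℝ) (w : W) (L : List W) :
    listEval μ (c • w :: L) = c • listEval μ (w :: L) := by
  have h : ∀ v : W, v :: L = List.ofFn (Fin.cons v L.get : Fin (L.length + 1) → W) := fun v => by
    simp
  rw [h, h w, listEval_ofFn, listEval_ofFn]
  exact (μ _).cons_smul _ _ _

theorem listEval_zsmul_cons (c : ℤ) (w : W) (L : List W) :
    listEval μ (c • w :: L) = c • listEval μ (w :: L) := by
  rw [← Int.cast_smul_eq_zsmul ℝ, listEval_smul_cons, Int.cast_smul_eq_zsmul]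

/-- The summand of the homotopy Jacobi identity for a splitting. -/
def jacobiTerm (emb : X → W) (A B : List X) : W :=
  (-1 : ℤ) ^ B.length • listEval μ (listEval μ (A.map emb) :: B.map emb)

theorem jacobiator_eq_splitSum (emb : X → W) (dg : X → ℤ) {n : ℕ} (x : Fin n → X) :
    jacobiator μ n (fun i => dg (x i)) (fun i => emb (x i)) =
      splitSum dg (jacobiTerm μ emb) (List.ofFn x) := by
  rw [← sum_isUnshuffle_eq_splitSum]
  refine Finset.sum_congr rfl fun j _ => Finset.sum_congr rfl fun σ _ => ?_
  have h₁ : ((List.ofFn fun i => x (σ i)).take j.val).map emb =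
      List.ofFn fun a : Fin j.val => emb (x (σ ⟨a.val, by omega⟩)) := by
    refine List.ext_getElem (by simp; omega) fun m _ _ => by simp
  have h₂ : ((List.ofFn fun i => x (σ i)).drop j.val).map emb =
      List.ofFn fun b : Fin (n - j.val) => emb (x (σ ⟨j.val + b.val, by omega⟩)) := by
    refine List.ext_getElem (by simp) fun m _ _ => by simp
  have h₃ : ∀ (w : W) {k : ℕ} (v : Fin k → W),
      w :: List.ofFn v = List.ofFn (Fin.cons w v : Fin (k + 1) → W) := fun w k v => by simp
  split_ifs
  · rw [jacobiTerm, h₁, h₂, listEval_ofFn, h₃, listEval_ofFn, mul_smul]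
    simp
  · rfl

theorem jacobiator_eq_zero_of_coord {n : ℕ} (deg : Fin n → ℤ) (l : Fin n → W) (i : Fin n)
    (h : l i = 0) : jacobiator μ n deg l = 0 := by
  refine Finset.sum_eq_zero fun j _ => Finset.sum_eq_zero fun σ _ => ?_
  split_ifs
  · rw [smul_eq_zero_of_right]
    by_cases hi : (σ.symm i).val < j.val
    · refine (μ _).map_coord_zero 0 ?_
      rw [Fin.cons_zero]
      exact (μ _).map_coord_zero ⟨(σ.symm i).val, hi⟩ (by simpa using h)
    · refine (μ _).map_coord_zero
        (Fin.succ ⟨(σ.symm i).val - j.val, by omega⟩) ?_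
      rw [Fin.cons_succ]
      have : (⟨j.val + ((σ.symm i).val - j.val), by omega⟩ : Fin n) = σ.symm i := by
        ext; simp only; omega
      simp only [this, Equiv.apply_symm_apply, h]
  · rfl

end ListEval

end LInfty

namespace DFT

/-! ### The algebra of brackets compatible with a metric and a derivative -/

/-- A skew bracket and a symmetric pairing on `E` with values in `V`, and a map `D : V → E`,
subject to the metric compatibility of a DFT algebroid. -/
structure MetricBracket (V E : Type*) [AddCommGroup V] [Module ℝ V] [AddCommGroup E]
    [Module ℝ E] where
  inner : E →ₗ[ℝ] E →ₗ[ℝ] V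
  D : V →ₗ[ℝ] E
  br : E →ₗ[ℝ] E →ₗ[ℝ] E
  inner_symm : ∀ a b, inner a b = inner b a
  br_skew : ∀ a b, br a b = -br b a
  compat : ∀ a b c, inner (br c a + D (inner c a)) b + inner a (br c b + D (inner c b)) =
    (2 : ℝ) • inner c (D (inner a b))

namespace MetricBracket

variable {V E : Type*} [AddCommGroup V] [Module ℝ V] [AddCommGroup E] [Module ℝ E]
  (S : MetricBracket V E)

/-- The trilinear form `⅓ ⟨[a, b], c⟩ + cyclic`. -/
noncomputable def N (a b c : E) : V :=
  (1 / 3 : ℝ) • (S.inner (S.br a b) c + S.inner (S.br b c) a + S.inner (S.br c a) b)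

/-- The Jacobiator of the bracket. -/
def Jac (a b c : E) : E := S.br (S.br a b) c + S.br (S.br b c) a + S.br (S.br c a) b

/-- The defect of the identity `Jac = D N`. -/
noncomputable def Q (a b c : E) : E := S.D (S.N a b c) - S.Jac a b c

/-- The defect of the identity `[e, D f] = D ⟨e, D f⟩`. -/
def K (e : E) (f : V) : E := S.br e (S.D f) - S.D (S.inner e (S.D f))

/-- Half the antisymmetrization of `⟨Q(a, b, c), e⟩`. -/
noncomputable def P (a b c e : E) : V :=
  (1 / 2 : ℝ) • (S.inner (S.Q a b c) e - S.inner (S.Q a b e) c + S.inner (S.Q a c e) b -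
    S.inner (S.Q b c e) a)

theorem N_swap₁ (a b c : E) : S.N b a c = -S.N a b c := by
  simp only [N]
  rw [S.br_skew b a, S.br_skew a c, S.br_skew c b]
  simp only [map_neg, LinearMap.neg_apply]
  module

theorem N_swap₂ (a b c : E) : S.N a c b = -S.N a b c := by
  simp only [N]
  rw [S.br_skew b a, S.br_skew a c, S.br_skew c b]
  simp only [map_neg, LinearMap.neg_apply]
  module

theorem N_add (a a' b c : E) : S.N (a + a') b c = S.N a b c + S.N a' b c := by
  simp only [N, map_add, LinearMap.add_apply]
  module

theorem N_smul (r : ℝ) (a b c : E) : S.N (r • a) b c = r • S.N a b c := by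
  simp only [N, map_smul, LinearMap.smul_apply]
  module

/-- Linearity in the later slots is carried over from the first one by antisymmetry; the same device
serves Q and P. -/
theorem N_add₂ (a a' b c : E) : S.N b (a + a') c = S.N b a c + S.N b a' c := by
  simp only [S.N_swap₁ _ b, N_add, neg_add]

theorem N_smul₂ (r : ℝ) (a b c : E) : S.N b (r • a) c = r • S.N b a c := by
  simp only [S.N_swap₁ _ b, N_smul, smul_neg]

theorem N_add₃ (a a' b c : E) : S.N b c (a + a') = S.N b c a + S.N b c a' := by
  simp only [S.N_swap₂ b _ c, N_add₂, neg_add]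

theorem N_smul₃ (r : ℝ) (a b c : E) : S.N b c (r • a) = r • S.N b c a := by
  simp only [S.N_swap₂ b _ c, N_smul₂, smul_neg]

theorem Q_swap₁ (a b c : E) : S.Q b a c = -S.Q a b c := by
  simp only [Q, Jac]
  rw [N_swap₁, S.br_skew b a, S.br_skew a c, S.br_skew c b]
  simp only [map_neg, LinearMap.neg_apply]
  module

theorem Q_swap₂ (a b c : E) : S.Q a c b = -S.Q a b c := by
  simp only [Q, Jac]
  rw [N_swap₂, S.br_skew b a, S.br_skew a c, S.br_skew c b]
  simp only [map_neg, LinearMap.neg_apply]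
  module

theorem Q_add (a a' b c : E) : S.Q (a + a') b c = S.Q a b c + S.Q a' b c := by
  simp only [Q, Jac, N_add, map_add, LinearMap.add_apply]
  module

theorem Q_smul (r : ℝ) (a b c : E) : S.Q (r • a) b c = r • S.Q a b c := by
  simp only [Q, Jac, N_smul, map_smul, LinearMap.smul_apply]
  module

theorem Q_add₂ (a a' b c : E) : S.Q b (a + a') c = S.Q b a c + S.Q b a' c := by
  simp only [S.Q_swap₁ _ b, Q_add, neg_add]

theorem Q_smul₂ (r : ℝ) (a b c : E) : S.Q b (r • a) c = r • S.Q b a c := by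
  simp only [S.Q_swap₁ _ b, Q_smul, smul_neg]

theorem Q_add₃ (a a' b c : E) : S.Q b c (a + a') = S.Q b c a + S.Q b c a' := by
  simp only [S.Q_swap₂ b _ c, Q_add₂, neg_add]

theorem Q_smul₃ (r : ℝ) (a b c : E) : S.Q b c (r • a) = r • S.Q b c a := by
  simp only [S.Q_swap₂ b _ c, Q_smul₂, smul_neg]

theorem P_swap₁ (a b c e : E) : S.P b a c e = -S.P a b c e := by
  simp only [P]
  rw [S.Q_swap₁ a b c, S.Q_swap₁ a b e]
  simp only [map_neg, LinearMap.neg_apply]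
  module

theorem P_swap₂ (a b c e : E) : S.P a c b e = -S.P a b c e := by
  simp only [P]
  rw [S.Q_swap₂ a b c, S.Q_swap₁ b c e]
  simp only [map_neg, LinearMap.neg_apply]
  module

theorem P_swap₃ (a b c e : E) : S.P a b e c = -S.P a b c e := by
  simp only [P]
  rw [S.Q_swap₂ a c e, S.Q_swap₂ b c e]
  simp only [map_neg, LinearMap.neg_apply]
  module

theorem P_add (a a' b c e : E) : S.P (a + a') b c e = S.P a b c e + S.P a' b c e := by
  simp only [P, Q_add, map_add, LinearMap.add_apply]
  module

theorem P_smul (r : ℝ) (a b c e : E) : S.P (r • a) b c e = r • S.P a b c e := by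
  simp only [P, Q_smul, map_smul, LinearMap.smul_apply]
  module

theorem P_add₂ (a a' b c e : E) : S.P b (a + a') c e = S.P b a c e + S.P b a' c e := by
  simp only [S.P_swap₁ _ b, P_add, neg_add]

theorem P_smul₂ (r : ℝ) (a b c e : E) : S.P b (r • a) c e = r • S.P b a c e := by
  simp only [S.P_swap₁ _ b, P_smul, smul_neg]

theorem P_add₃ (a a' b c e : E) : S.P b c (a + a') e = S.P b c a e + S.P b c a' e := by
  simp only [S.P_swap₂ b _ c, P_add₂, neg_add]

theorem P_smul₃ (r : ℝ) (a b c e : E) : S.P b c (r • a) e = r • S.P b c a e := by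
  simp only [S.P_swap₂ b _ c, P_smul₂, smul_neg]

theorem P_add₄ (a a' b c e : E) : S.P b c e (a + a') = S.P b c e a + S.P b c e a' := by
  simp only [S.P_swap₃ b c _ e, P_add₃, neg_add]

theorem P_smul₄ (r : ℝ) (a b c e : E) : S.P b c e (r • a) = r • S.P b c e a := by
  simp only [S.P_swap₃ b c _ e, P_smul₃, smul_neg]

section Zero

variable (a b c : E)

@[simp] theorem N_zero₁ : S.N 0 a b = 0 := by simpa using S.N_smul 0 0 a b
@[simp] theorem N_zero₂ : S.N a 0 b = 0 := by simpa using S.N_smul₂ 0 0 a b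
@[simp] theorem N_zero₃ : S.N a b 0 = 0 := by simpa using S.N_smul₃ 0 0 a b
@[simp] theorem Q_zero₁ : S.Q 0 a b = 0 := by simpa using S.Q_smul 0 0 a b
@[simp] theorem Q_zero₂ : S.Q a 0 b = 0 := by simpa using S.Q_smul₂ 0 0 a b
@[simp] theorem Q_zero₃ : S.Q a b 0 = 0 := by simpa using S.Q_smul₃ 0 0 a b
@[simp] theorem P_zero₁ : S.P 0 a b c = 0 := by simpa using S.P_smul 0 0 a b c
@[simp] theorem P_zero₂ : S.P a 0 b c = 0 := by simpa using S.P_smul₂ 0 0 a b c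
@[simp] theorem P_zero₃ : S.P a b 0 c = 0 := by simpa using S.P_smul₃ 0 0 a b c
@[simp] theorem P_zero₄ : S.P a b c 0 = 0 := by simpa using S.P_smul₄ 0 0 a b c
@[simp] theorem K_zero_left (f : V) : S.K 0 f = 0 := by simp [K]
@[simp] theorem K_zero_right : S.K a 0 = 0 := by simp [K]

end Zero

theorem K_add_left (a a' : E) (f : V) : S.K (a + a') f = S.K a f + S.K a' f := by
  simp only [K, map_add, LinearMap.add_apply]; module

theorem K_smul_left (r : ℝ) (a : E) (f : V) : S.K (r • a) f = r • S.K a f := by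
  simp only [K, map_smul, LinearMap.smul_apply]; module

theorem K_add_right (a : E) (f f' : V) : S.K a (f + f') = S.K a f + S.K a f' := by
  simp only [K, map_add]; module

theorem K_smul_right (r : ℝ) (a : E) (f : V) : S.K a (r • f) = r • S.K a f := by
  simp only [K, map_smul]; module

/-! ### Consequences of metric compatibility. -/

/-- The bracket is determined by `N` and the derivative of the pairing. -/
theorem inner_br (a b c : E) : S.inner (S.br a b) c =
    S.N a b c + S.inner a (S.D (S.inner b c)) - S.inner b (S.D (S.inner a c)) := by
  have h₁ := S.compat b c a
  have h₂ := S.compat c a b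
  simp only [map_add, LinearMap.add_apply, S.inner_symm (S.D _), S.inner_symm b (S.br _ _),
    S.inner_symm c (S.br _ _), S.br_skew a c, S.br_skew b a, S.inner_symm b a, S.inner_symm c a,
    map_neg] at h₁ h₂
  simp only [N]
  -- With X, Y, Z the three cyclic terms of 3N, the difference of the two instances computes 2X - Y
  -- - Z = 3(X - N), and ⟨c, D⟨a,b⟩⟩ drops out.
  linear_combination (norm := module) (1 / 3 : ℝ) • h₁ - (1 / 3 : ℝ) • h₂

/-- This is `inner_br` with third argument Df, solved for N. -/
theorem N_D (f : V) (a b : E) : S.N (S.D f) a b = S.inner (S.br a b) (S.D f) +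
    S.inner b (S.D (S.inner a (S.D f))) - S.inner a (S.D (S.inner b (S.D f))) := by
  rw [inner_br, S.N_swap₁ a, S.N_swap₂ a b]
  abel_nf

/-- Let U be the signed sum of N([x,y],z,w) over the six pairs, C that of ⟨Jac(x,y,z),w⟩, and S that
of ⟨[x,y],[z,w]⟩. The definition of N gives 3U = C + S. By `inner_br`, S equals U plus D-terms,
which assemble to -3 times the signed sum of ⟨w, D N(x,y,z)⟩. Eliminating S leaves 2U in terms of C
and the D-terms, which is the claim. -/
theorem P_eq (a b c e : E) : S.P a b c e =
    -(S.N (S.br a b) c e - S.N (S.br a c) b e + S.N (S.br a e) b c +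
      S.N (S.br b c) a e - S.N (S.br b e) a c + S.N (S.br c e) a b) -
    (S.inner e (S.D (S.N a b c)) - S.inner c (S.D (S.N a b e)) + S.inner b (S.D (S.N a c e)) -
      S.inner a (S.D (S.N b c e))) := by
  have hI : ∀ x y z w : E, S.inner (S.br x y) (S.br z w) = S.N (S.br z w) x y +
      S.inner x (S.D (S.inner (S.br z w) y)) - S.inner y (S.D (S.inner (S.br z w) x)) :=
    fun x y z w => by
      rw [inner_br, S.N_swap₁ x, S.N_swap₂ x y, neg_neg, S.inner_symm y, S.inner_symm x (S.br z w)]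
  have hU : ∀ x y z w : E, S.N (S.br x y) z w = (1 / 3 : ℝ) • (S.inner (S.br (S.br x y) z) w -
      S.inner (S.br (S.br x y) w) z + S.inner (S.br x y) (S.br z w)) :=
    fun x y z w => by
      rw [N, S.br_skew w, S.inner_symm (S.br z w), map_neg, LinearMap.neg_apply]
      module
  have u₁ := hU a b c e
  have u₂ := hU a c b e
  have u₃ := hU a e b c
  have u₄ := hU b c a e
  have u₅ := hU b e a c
  have u₆ := hU c e a b
  have i₁ := hI a b c e
  have i₂ := hI a c b e
  have i₃ := hI a e b c
  have i₄ := hI b c a e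
  have i₅ := hI b e a c
  have i₆ := hI c e a b
  have d : ∀ x y z w : E, S.inner w (S.D (S.N x y z)) = (1 / 3 : ℝ) •
      (S.inner w (S.D (S.inner (S.br x y) z)) + S.inner w (S.D (S.inner (S.br y z) x)) -
        S.inner w (S.D (S.inner (S.br x z) y))) := fun x y z w => by
    simp only [N, S.br_skew z x, map_smul, map_add, map_neg, LinearMap.neg_apply]
    module
  have q : ∀ x y z w : E, S.inner (S.Q x y z) w = S.inner w (S.D (S.N x y z)) -
      S.inner (S.br (S.br x y) z) w - S.inner (S.br (S.br y z) x) w +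
      S.inner (S.br (S.br x z) y) w := fun x y z w => by
    simp only [Q, Jac, S.br_skew z x, S.inner_symm w, map_sub, map_add, map_neg,
      LinearMap.neg_apply, LinearMap.sub_apply, LinearMap.add_apply]
    module
  simp only [P, q, d]
  -- The weights 3/2 and 1/2 are half of those in 3U = C + S and S = U + (D-terms).
  linear_combination (norm := module) (3 / 2 : ℝ) • (u₁ - u₂ + u₃ + u₄ - u₅ + u₆) +
    (1 / 2 : ℝ) • (i₁ - i₂ + i₃ + i₄ - i₅ + i₆)

/-! ### The structure maps on arbitrary triples (function, section, scalar). -/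

/-- The map of arity one. -/
def mu₁ : MultilinearMap ℝ (fun _ : Fin 1 => V × E × ℝ) (V × E × ℝ) :=
  .mk' (fun l => (0, S.D (l 0).1, 0))
  (fun l i x y => by fin_cases i; simp)
  (fun l i r x => by fin_cases i; simp)

/-- The map of arity two. -/
def mu₂ : MultilinearMap ℝ (fun _ : Fin 2 => V × E × ℝ) (V × E × ℝ) :=
  .mk' (fun l => (S.inner (l 0).2.1 (S.D (l 1).1) - S.inner (l 1).2.1 (S.D (l 0).1),
    S.br (l 0).2.1 (l 1).2.1, 0))
  (fun l i x y => by
    fin_cases i <;> refine Prod.ext ?_ (Prod.ext ?_ ?_) <;> simp <;> module)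
  (fun l i r x => by
    fin_cases i <;> refine Prod.ext ?_ (Prod.ext ?_ ?_) <;> simp <;> module)

/-- The map of arity three. -/
noncomputable def mu₃ : MultilinearMap ℝ (fun _ : Fin 3 => V × E × ℝ) (V × E × ℝ) :=
  -- The scalar may sit in any slot, and moving it past a neighbour costs a sign. Exchanging a
  -- section and a function also costs a sign, while two functions commute, in accordance with the
  -- symmetry of ⟨Df, Dg⟩.
  .mk' (fun l => (S.N (l 0).2.1 (l 1).2.1 (l 2).2.1 + (2 : ℝ) •
      ((l 0).2.2 • S.inner (S.D (l 1).1) (S.D (l 2).1) -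
        (l 1).2.2 • S.inner (S.D (l 0).1) (S.D (l 2).1) +
        (l 2).2.2 • S.inner (S.D (l 0).1) (S.D (l 1).1)),
    (l 0).2.2 • (S.K (l 1).2.1 (l 2).1 - S.K (l 2).2.1 (l 1).1) -
      (l 1).2.2 • (S.K (l 0).2.1 (l 2).1 - S.K (l 2).2.1 (l 0).1) +
      (l 2).2.2 • (S.K (l 0).2.1 (l 1).1 - S.K (l 1).2.1 (l 0).1), 0))
  (fun l i x y => by
    fin_cases i <;> refine Prod.ext ?_ (Prod.ext ?_ ?_) <;>
      simp [N_add, N_add₂, N_add₃, K_add_left, K_add_right] <;> module)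
  (fun l i r x => by
    fin_cases i <;> refine Prod.ext ?_ (Prod.ext ?_ ?_) <;>
      simp [N_smul, N_smul₂, N_smul₃, K_smul_left, K_smul_right] <;> module)

/-- The map of arity four. -/
noncomputable def mu₄ : MultilinearMap ℝ (fun _ : Fin 4 => V × E × ℝ) (V × E × ℝ) :=
  .mk' (fun l => (0, (l 0).2.2 • S.Q (l 1).2.1 (l 2).2.1 (l 3).2.1 -
    (l 1).2.2 • S.Q (l 0).2.1 (l 2).2.1 (l 3).2.1 +
    (l 2).2.2 • S.Q (l 0).2.1 (l 1).2.1 (l 3).2.1 -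
    (l 3).2.2 • S.Q (l 0).2.1 (l 1).2.1 (l 2).2.1, 0))
  (fun l i x y => by
    fin_cases i <;> refine Prod.ext ?_ (Prod.ext ?_ ?_) <;>
      simp [Q_add, Q_add₂, Q_add₃] <;> module)
  (fun l i r x => by
    fin_cases i <;> refine Prod.ext ?_ (Prod.ext ?_ ?_) <;>
      simp [Q_smul, Q_smul₂, Q_smul₃] <;> module)

/-- The map of arity five. -/
noncomputable def mu₅ : MultilinearMap ℝ (fun _ : Fin 5 => V × E × ℝ) (V × E × ℝ) :=
  .mk' (fun l => ((l 0).2.2 • S.P (l 1).2.1 (l 2).2.1 (l 3).2.1 (l 4).2.1 -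
    (l 1).2.2 • S.P (l 0).2.1 (l 2).2.1 (l 3).2.1 (l 4).2.1 +
    (l 2).2.2 • S.P (l 0).2.1 (l 1).2.1 (l 3).2.1 (l 4).2.1 -
    (l 3).2.2 • S.P (l 0).2.1 (l 1).2.1 (l 2).2.1 (l 4).2.1 +
    (l 4).2.2 • S.P (l 0).2.1 (l 1).2.1 (l 2).2.1 (l 3).2.1, 0, 0))
  (fun l i x y => by
    fin_cases i <;> refine Prod.ext ?_ (Prod.ext ?_ ?_) <;>
      simp [P_add, P_add₂, P_add₃, P_add₄] <;> module)
  (fun l i r x => by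
    fin_cases i <;> refine Prod.ext ?_ (Prod.ext ?_ ?_) <;>
      simp [P_smul, P_smul₂, P_smul₃, P_smul₄] <;> module)

/-- The structure maps of all arities. -/
noncomputable def mu : ∀ n : ℕ, MultilinearMap ℝ (fun _ : Fin n => V × E × ℝ) (V × E × ℝ)
  | 0 => MultilinearMap.constOfIsEmpty ℝ _ (0, 0, 1)
  | 1 => S.mu₁
  | 2 => S.mu₂
  | 3 => S.mu₃
  | 4 => S.mu₄
  | 5 => S.mu₅
  | _ => 0

/-- The structure maps on lists. -/
noncomputable abbrev ev (L : List (V × E × ℝ)) : V × E × ℝ := LInfty.listEval S.mu L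

/-- This and the next formulas hold definitionally: the length of an explicit list reduces to a
numeral, which selects the branch of `mu`. -/
theorem ev_nil : S.ev [] = (0, 0, 1) := rfl

theorem ev_one (a : V × E × ℝ) : S.ev [a] = (0, S.D a.1, 0) := rfl

theorem ev_two (a b : V × E × ℝ) : S.ev [a, b] =
    (S.inner a.2.1 (S.D b.1) - S.inner b.2.1 (S.D a.1), S.br a.2.1 b.2.1, 0) := rfl

theorem ev_three (a b c : V × E × ℝ) : S.ev [a, b, c] =
    (S.N a.2.1 b.2.1 c.2.1 + (2 : ℝ) • (a.2.2 • S.inner (S.D b.1) (S.D c.1) -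
        b.2.2 • S.inner (S.D a.1) (S.D c.1) + c.2.2 • S.inner (S.D a.1) (S.D b.1)),
    a.2.2 • (S.K b.2.1 c.1 - S.K c.2.1 b.1) - b.2.2 • (S.K a.2.1 c.1 - S.K c.2.1 a.1) +
      c.2.2 • (S.K a.2.1 b.1 - S.K b.2.1 a.1), 0) := rfl

theorem ev_four (a b c e : V × E × ℝ) : S.ev [a, b, c, e] =
    (0, a.2.2 • S.Q b.2.1 c.2.1 e.2.1 - b.2.2 • S.Q a.2.1 c.2.1 e.2.1 +
      c.2.2 • S.Q a.2.1 b.2.1 e.2.1 - e.2.2 • S.Q a.2.1 b.2.1 c.2.1, 0) := rfl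

theorem ev_five (a b c e g : V × E × ℝ) : S.ev [a, b, c, e, g] =
    (a.2.2 • S.P b.2.1 c.2.1 e.2.1 g.2.1 - b.2.2 • S.P a.2.1 c.2.1 e.2.1 g.2.1 +
      c.2.2 • S.P a.2.1 b.2.1 e.2.1 g.2.1 - e.2.2 • S.P a.2.1 b.2.1 c.2.1 g.2.1 +
      g.2.2 • S.P a.2.1 b.2.1 c.2.1 e.2.1, 0, 0) := rfl

theorem ev_six (a b c e g h : V × E × ℝ) (L : List (V × E × ℝ)) :
    S.ev (a :: b :: c :: e :: g :: h :: L) = 0 := rfl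

end MetricBracket

/-! ### Homogeneous elements, degrees and support of the structure maps. -/

/-- Homogeneous elements of `V ⊕ E ⊕ ℝ`, in degrees `-1`, `0` and `2`. -/
inductive HomElt (V E : Type*)
  | fn (f : V)
  | sec (e : E)
  | curv (c : ℝ)

namespace HomElt

variable {V E : Type*}

/-- The degree of a homogeneous element. -/
def deg : HomElt V E → ℤ
  | fn _ => -1
  | sec _ => 0
  | curv _ => 2

@[simp] theorem deg_fn (f : V) : (fn f : HomElt V E).deg = -1 := rfl
@[simp] theorem deg_sec (e : E) : (sec e : HomElt V E).deg = 0 := rfl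
@[simp] theorem deg_curv (c : ℝ) : (curv c : HomElt V E).deg = 2 := rfl

/-- Only two functions have an odd product of degrees. -/
theorem swapSign_eq (x y : HomElt V E) : LInfty.swapSign deg x y =
    match x, y with
    | fn _, fn _ => 1
    | _, _ => -1 := by
  rcases x with f | e | c <;> rcases y with f' | e' | c' <;> rfl

variable [AddCommGroup V] [AddCommGroup E]

/-- The underlying element of the total space. -/
def val : HomElt V E → V × E × ℝ
  | fn f => (f, 0, 0)
  | sec e => (0, e, 0)
  | curv c => (0, 0, c)

@[simp] theorem val_fn (f : V) : (fn f : HomElt V E).val = (f, 0, 0) := rfl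
@[simp] theorem val_sec (e : E) : (sec e : HomElt V E).val = (0, e, 0) := rfl
@[simp] theorem val_curv (c : ℝ) : (curv c : HomElt V E).val = (0, 0, c) := rfl

end HomElt

namespace MetricBracket

open HomElt LInfty

variable {V E : Type*} [AddCommGroup V] [Module ℝ V] [AddCommGroup E] [Module ℝ E]

/-- The component of degree `i` of `V ⊕ E ⊕ ℝ`. -/
def gr (V E : Type*) [AddCommGroup V] [Module ℝ V] [AddCommGroup E] [Module ℝ E] (i : ℤ) :
    Submodule ℝ (V × E × ℝ) where
  carrier := {w | (i ≠ -1 → w.1 = 0) ∧ (i ≠ 0 → w.2.1 = 0) ∧ (i ≠ 2 → w.2.2 = 0)}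
  zero_mem' := ⟨fun _ => rfl, fun _ => rfl, fun _ => rfl⟩
  add_mem' := fun {a b} ha hb =>
    ⟨fun h => by rw [Prod.fst_add, ha.1 h, hb.1 h, add_zero],
      fun h => by rw [Prod.snd_add, Prod.fst_add, ha.2.1 h, hb.2.1 h, add_zero],
      fun h => by rw [Prod.snd_add, Prod.snd_add, ha.2.2 h, hb.2.2 h, add_zero]⟩
  smul_mem' := fun c a ha =>
    ⟨fun h => by rw [Prod.smul_fst, ha.1 h, smul_zero],
      fun h => by rw [Prod.smul_snd, Prod.smul_fst, ha.2.1 h, smul_zero],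
      fun h => by rw [Prod.smul_snd, Prod.smul_snd, ha.2.2 h, smul_zero]⟩

theorem mem_gr {i : ℤ} {w : V × E × ℝ} : w ∈ gr V E i ↔
    (i ≠ -1 → w.1 = 0) ∧ (i ≠ 0 → w.2.1 = 0) ∧ (i ≠ 2 → w.2.2 = 0) := Iff.rfl

/-- Zero lies in every degree, so it has to be split off before the degree can determine the type of
an element. -/
theorem exists_val_of_mem_gr {i : ℤ} {w : V × E × ℝ} (hw : w ∈ gr V E i) :
    w = 0 ∨ ∃ x : HomElt V E, x.val = w ∧ x.deg = i := by
  obtain ⟨f, e, c⟩ := w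
  obtain ⟨h₁, h₂, h₃⟩ := mem_gr.1 hw
  simp only at h₁ h₂ h₃
  by_cases a : i = -1
  · exact Or.inr ⟨fn f, by simp [h₂ (by omega), h₃ (by omega)], a.symm⟩
  by_cases b : i = 0
  · exact Or.inr ⟨sec e, by simp [h₁ (by omega), h₃ (by omega)], b.symm⟩
  by_cases c' : i = 2
  · exact Or.inr ⟨curv c, by simp [h₁ (by omega), h₂ (by omega)], c'.symm⟩
  · exact Or.inl (by simp [h₁ a, h₂ b, h₃ c'])

theorem eq_zero_of_mem_gr {i : ℤ} {w : V × E × ℝ} (hw : w ∈ gr V E i) (h₁ : i ≠ -1)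
    (h₂ : i ≠ 0) (h₃ : i ≠ 2) : w = 0 :=
  Prod.ext (hw.1 h₁) (Prod.ext (hw.2.1 h₂) (hw.2.2 h₃))

variable (S : MetricBracket V E)

/-- The combinations of degrees on which the structure maps may be nonzero. -/
def supp : Set (Multiset ℤ) :=
  {0, {-1}, {0, 0}, {0, -1}, {0, 0, 0}, {2, 0, -1}, {2, -1, -1}, {2, 0, 0, 0}, {2, 0, 0, 0, 0}}

theorem ev_mem_gr (L : List (HomElt V E)) :
    S.ev (L.map val) ∈ gr V E ((L.map deg).sum + 2 - L.length) := by
  match L with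
  | [] => simp [ev_nil, mem_gr]
  | [x] => rcases x with f | e | c <;> simp [ev_one, mem_gr]
  | [x, y] =>
    rcases x with f | e | c <;> rcases y with f' | e' | c' <;> simp [ev_two, mem_gr]
  | [x, y, z] =>
    rcases x with f | e | c <;> rcases y with f' | e' | c' <;> rcases z with f'' | e'' | c'' <;>
      simp [ev_three, mem_gr]
  | [x, y, z, w] =>
    rcases x with f | e | c <;> rcases y with f' | e' | c' <;> rcases z with f'' | e'' | c'' <;>
      rcases w with f₃ | e₃ | c₃ <;> simp [ev_four, mem_gr]
  | [x, y, z, w, u] =>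
    rcases x with f | e | c <;> try (simp [ev_five, mem_gr]; done)
    all_goals rcases y with f' | e' | c' <;> try (simp [ev_five, mem_gr]; done)
    all_goals rcases z with f' | e' | c' <;> try (simp [ev_five, mem_gr]; done)
    all_goals rcases w with f' | e' | c' <;> try (simp [ev_five, mem_gr]; done)
    all_goals rcases u with f' | e' | c' <;> simp [ev_five, mem_gr]
  | _ :: _ :: _ :: _ :: _ :: _ :: _ => exact zero_mem _

theorem ev_eq_zero (L : List (HomElt V E)) (h : (↑(L.map deg) : Multiset ℤ) ∉ supp) :
    S.ev (L.map val) = 0 := by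
  match L with
  | [] => exact absurd (Or.inl rfl) h
  | [x] =>
    rcases x with f | e | c <;> first
        | (simp [ev_one]; done)
        | exact absurd (by
            simp only [List.map, deg_fn, supp, Set.mem_insert_iff,
              Set.mem_singleton_iff]
            decide) h
  | [x, y] =>
    rcases x with f | e | c <;> rcases y with f' | e' | c' <;> first
        | (simp [ev_two]; done)
        | exact absurd (by
            simp only [List.map, deg_fn, deg_sec, supp, Set.mem_insert_iff,
              Set.mem_singleton_iff]
            decide) h
  | [x, y, z] =>
    rcases x with f | e | c <;> rcases y with f' | e' | c' <;>
      rcases z with f'' | e'' | c'' <;> first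
        | (simp [ev_three]; done)
        | exact absurd (by
            simp only [List.map, deg_fn, deg_sec, deg_curv, supp, Set.mem_insert_iff,
              Set.mem_singleton_iff]
            decide) h
  | [x, y, z, w] =>
    rcases x with f | e | c <;> try (simp [ev_four]; done)
    all_goals rcases y with f | e | c <;> try (simp [ev_four]; done)
    all_goals rcases z with f | e | c <;> try (simp [ev_four]; done)
    all_goals rcases w with f | e | c <;> first
        | (simp [ev_four]; done)
        | exact absurd (by
            simp only [List.map, deg_sec, deg_curv, supp, Set.mem_insert_iff,
              Set.mem_singleton_iff]
            decide) h
  | [x, y, z, w, u] =>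
    rcases x with f | e | c <;> try (simp [ev_five]; done)
    all_goals rcases y with f | e | c <;> try (simp [ev_five]; done)
    all_goals rcases z with f | e | c <;> try (simp [ev_five]; done)
    all_goals rcases w with f | e | c <;> try (simp [ev_five]; done)
    all_goals rcases u with f | e | c <;> first
        | (simp [ev_five]; done)
        | exact absurd (by
            simp only [List.map, deg_sec, deg_curv, supp, Set.mem_insert_iff,
              Set.mem_singleton_iff]
            decide) h
  | _ :: _ :: _ :: _ :: _ :: _ :: _ => rfl

theorem ev_eq_zero_of_length {L : List (V × E × ℝ)} (h : 6 ≤ L.length) : S.ev L = 0 := by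
  rcases L with _ | ⟨_, _ | ⟨_, _ | ⟨_, _ | ⟨_, _ | ⟨_, _ | ⟨_, _⟩⟩⟩⟩⟩⟩
  all_goals first | rfl | simp at h

/-! ### Graded antisymmetry of the structure maps. -/

section Swap

variable (u v a b c : V × E × ℝ)

theorem ev_two_swap : S.ev [u, v] = -S.ev [v, u] := by
  simp only [ev_two, Prod.neg_mk, neg_sub, neg_zero, ← S.br_skew]

/-- The hypothesis excludes the term ⟨Df, Dg⟩ with both functions in the exchanged slots, the only
one that is symmetric under the exchange. -/
theorem ev_three_swap₁ (h : u.1 = 0 ∨ v.1 = 0) : S.ev [u, v, a] = -S.ev [v, u, a] := by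
  simp only [ev_three, S.N_swap₁ v.2.1 u.2.1]
  refine Prod.ext ?_ (Prod.ext ?_ ?_)
  · rcases h with h | h <;> simp [h] <;> module
  · simp only [Prod.neg_mk]; module
  · simp

theorem ev_three_swap₂ (h : u.1 = 0 ∨ v.1 = 0) : S.ev [a, u, v] = -S.ev [a, v, u] := by
  simp only [ev_three, S.N_swap₂ _ v.2.1 u.2.1]
  refine Prod.ext ?_ (Prod.ext ?_ ?_)
  · rcases h with h | h <;> simp [h] <;> module
  · simp only [Prod.neg_mk]; module
  · simp

theorem ev_four_swap₁ : S.ev [u, v, a, b] = -S.ev [v, u, a, b] := by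
  simp only [ev_four, S.Q_swap₁ v.2.1 u.2.1, Prod.neg_mk, neg_zero]
  refine Prod.ext rfl (Prod.ext ?_ rfl)
  module

theorem ev_four_swap₂ : S.ev [a, u, v, b] = -S.ev [a, v, u, b] := by
  simp only [ev_four, S.Q_swap₁ v.2.1 u.2.1, S.Q_swap₂ _ v.2.1 u.2.1, Prod.neg_mk, neg_zero]
  refine Prod.ext rfl (Prod.ext ?_ rfl)
  module

theorem ev_four_swap₃ : S.ev [a, b, u, v] = -S.ev [a, b, v, u] := by
  simp only [ev_four, S.Q_swap₂ _ v.2.1 u.2.1, Prod.neg_mk, neg_zero]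
  refine Prod.ext rfl (Prod.ext ?_ rfl)
  module

theorem ev_five_swap₁ : S.ev [u, v, a, b, c] = -S.ev [v, u, a, b, c] := by
  simp only [ev_five, S.P_swap₁ v.2.1 u.2.1, Prod.neg_mk, neg_zero]
  refine Prod.ext ?_ rfl
  module

theorem ev_five_swap₂ : S.ev [a, u, v, b, c] = -S.ev [a, v, u, b, c] := by
  simp only [ev_five, S.P_swap₁ v.2.1 u.2.1, S.P_swap₂ _ v.2.1 u.2.1, Prod.neg_mk, neg_zero]
  refine Prod.ext ?_ rfl
  module

theorem ev_five_swap₃ : S.ev [a, b, u, v, c] = -S.ev [a, b, v, u, c] := by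
  simp only [ev_five, S.P_swap₂ _ v.2.1 u.2.1, S.P_swap₃ _ _ v.2.1 u.2.1, Prod.neg_mk, neg_zero]
  refine Prod.ext ?_ rfl
  module

theorem ev_five_swap₄ : S.ev [a, b, c, u, v] = -S.ev [a, b, c, v, u] := by
  simp only [ev_five, S.P_swap₃ _ _ v.2.1 u.2.1, Prod.neg_mk, neg_zero]
  refine Prod.ext ?_ rfl
  module

end Swap

theorem swapSign_cases (x y : HomElt V E) :
    ((x.val.1 = 0 ∨ y.val.1 = 0) ∧ swapSign deg x y = -1) ∨
      ∃ f g, x = fn f ∧ y = fn g := by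
  rcases x with f | e | c <;> rcases y with f' | e' | c' <;> simp [swapSign_eq]

theorem ev_swap (x y : HomElt V E) (A B : List (V × E × ℝ)) :
    S.ev (A ++ x.val :: y.val :: B) = swapSign deg x y • S.ev (A ++ y.val :: x.val :: B) := by
  by_cases h : 6 ≤ (A ++ x.val :: y.val :: B).length
  · rw [S.ev_eq_zero_of_length h, S.ev_eq_zero_of_length (by simpa using h), smul_zero]
  simp only [List.length_append, List.length_cons] at h
  rcases swapSign_cases x y with ⟨h₀, hs⟩ | ⟨f, g, rfl, rfl⟩
  · rw [hs, neg_one_smul]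
    rcases A with _ | ⟨a, _ | ⟨b, _ | ⟨c, _ | ⟨_, A⟩⟩⟩⟩ <;>
      rcases B with _ | ⟨a', _ | ⟨b', _ | ⟨c', _ | ⟨_, B⟩⟩⟩⟩ <;>
      simp only [List.length_cons, List.length_nil] at h <;> first | omega | skip
    · exact S.ev_two_swap _ _
    · exact S.ev_three_swap₁ _ _ _ h₀
    · exact S.ev_four_swap₁ _ _ _ _
    · exact S.ev_five_swap₁ _ _ _ _ _
    · exact S.ev_three_swap₂ _ _ _ h₀
    · exact S.ev_four_swap₂ _ _ _ _
    · exact S.ev_five_swap₂ _ _ _ _ _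
    · exact S.ev_four_swap₃ _ _ _ _
    · exact S.ev_five_swap₃ _ _ _ _ _
    · exact S.ev_five_swap₄ _ _ _ _ _
  · rw [swapSign_eq, one_smul]
    rcases A with _ | ⟨a, _ | ⟨b, _ | ⟨c, _ | ⟨_, A⟩⟩⟩⟩ <;>
      rcases B with _ | ⟨a', _ | ⟨b', _ | ⟨c', _ | ⟨_, B⟩⟩⟩⟩ <;>
      simp only [List.length_cons, List.length_nil] at h <;> first | omega | skip
    all_goals simp [ev_two, ev_three, ev_four, ev_five, S.inner_symm (S.D f)]

/-- The graded antisymmetry of the summands of the homotopy Jacobi identities. -/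
theorem splitAntisymm_jacobiTerm : SplitAntisymm deg (jacobiTerm S.mu (val (V := V) (E := E))) := by
  refine ⟨fun A₁ x y A₂ B => ?_, fun A B₁ x y B₂ => ?_⟩
  · simp only [jacobiTerm, List.map_append, List.map_cons, S.ev_swap x y, listEval_zsmul_cons]
    rw [smul_comm]
  · have := S.ev_swap x y (listEval S.mu (A.map val) :: B₁.map val) (B₂.map val)
    simp only [List.cons_append] at this
    simp only [jacobiTerm, List.map_append, List.map_cons, List.length_append, List.length_cons,
      this]
    rw [smul_comm]

theorem N_neg (a b c : E) : S.N (-a) b c = -S.N a b c := by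
  simpa using S.N_smul (-1) a b c

theorem N_sub (a a' b c : E) : S.N (a - a') b c = S.N a b c - S.N a' b c := by
  rw [sub_eq_add_neg, N_add, N_neg, ← sub_eq_add_neg]

/-- The left-hand side of the homotopy Jacobi identity on a list of homogeneous elements. -/
noncomputable def J (L : List (HomElt V E)) : V × E × ℝ :=
  splitSum deg (jacobiTerm S.mu val) L

/-! The homotopy Jacobi identities on sorted arguments; the letters `c`, `e`, `f` in the names stand
for multiples of the curvature, sections and functions. -/

theorem J_e (e : E) : S.J [sec e] = 0 := by
  simp [J, splitSum, jacobiTerm, passSign, ev_nil, ev_one, ev_two]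

/-- The j = 0 term μ₃(μ₀, e, f) is K(e, f), the defect of [e, Df] = D⟨e, Df⟩; likewise 2⟨Df, Dg⟩
closes `J_ff` and Q closes `J_eee`. -/
theorem J_ef (e : E) (f : V) : S.J [sec e, fn f] = 0 := by
  simp [J, splitSum, jacobiTerm, passSign, swapSign_eq, ev_nil, ev_one, ev_two, ev_three]
  rw [K, S.br_skew (S.D f)]
  module

theorem J_ff (f g : V) : S.J [fn f, fn g] = 0 := by
  simp [J, splitSum, jacobiTerm, passSign, swapSign_eq, ev_nil, ev_one, ev_two, ev_three]
  rw [S.inner_symm (S.D g)]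
  module

theorem J_eee (a b c : E) : S.J [sec a, sec b, sec c] = 0 := by
  simp [J, splitSum, jacobiTerm, passSign, swapSign_eq, ev_nil, ev_one, ev_two, ev_three, ev_four]
  simp only [Q, Jac, S.br_skew c a, map_neg, LinearMap.neg_apply]
  module

/-- Here no map with μ₀ can absorb a defect, since μ₄ vanishes in these degrees; the identity is a
genuine consequence of compatibility. -/
theorem J_eef (a b : E) (f : V) : S.J [sec a, sec b, fn f] = 0 := by
  simp [J, splitSum, jacobiTerm, passSign, swapSign_eq, ev_nil, ev_one, ev_two, ev_three, ev_four]
  rw [N_D]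
  module

theorem J_eeee (a b c e : E) : S.J [sec a, sec b, sec c, sec e] = 0 := by
  simp [J, splitSum, jacobiTerm, passSign, swapSign_eq, ev_nil, ev_one, ev_two, ev_three, ev_four,
    ev_five]
  rw [P_eq]
  module

theorem J_cee (s : ℝ) (a b : E) : S.J [curv s, sec a, sec b] = 0 := by
  simp [J, splitSum, jacobiTerm, passSign, swapSign_eq, ev_nil, ev_one, ev_two, ev_three, ev_four]

theorem J_cf (s : ℝ) (f : V) : S.J [curv s, fn f] = 0 := by
  simp [J, splitSum, jacobiTerm, passSign, swapSign_eq, ev_nil, ev_one, ev_two, ev_three]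

theorem J_cff (s : ℝ) (f g : V) : S.J [curv s, fn f, fn g] = 0 := by
  simp [J, splitSum, jacobiTerm, passSign, swapSign_eq, ev_nil, ev_one, ev_two, ev_three, ev_four]
  simp only [K, S.br_skew (S.D g) (S.D f), S.inner_symm (S.D g) (S.D f)]
  module

/-- `N_D` expands D N(Df, a, b) inside Q; the double brackets and the D-terms then cancel against
those of K. -/
theorem J_ceef (s : ℝ) (a b : E) (f : V) : S.J [curv s, sec a, sec b, fn f] = 0 := by
  simp [J, splitSum, jacobiTerm, passSign, swapSign_eq, ev_nil, ev_one, ev_two, ev_three, ev_four,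
    ev_five]
  simp only [K, Q, Jac, N_D, S.br_skew (S.D _), map_sub, map_add, map_neg, LinearMap.sub_apply,
    LinearMap.neg_apply]
  module

theorem J_ceff (s : ℝ) (a : E) (f g : V) : S.J [curv s, sec a, fn f, fn g] = 0 := by
  simp [J, splitSum, jacobiTerm, passSign, swapSign_eq, ev_nil, ev_one, ev_two, ev_three, ev_four,
    ev_five]
  -- The sum of the terms is s times compatibility for the sections Df, Dg acted on by a.
  have h := S.compat (S.D f) (S.D g) a
  simp only [map_add, LinearMap.add_apply] at h
  rw [S.inner_symm (S.D f) (S.br _ _), S.inner_symm (S.D f) (S.D (S.inner a (S.D g)))] at h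
  simp only [K, map_sub, LinearMap.sub_apply]
  linear_combination (norm := module) (-s) • h

/-- After `P_eq`, the terms containing D cancel. What remains relates Jac([a,b],c,e) to
[Jac(a,b,c),e] and holds for every skew bracket. -/
theorem J_ceeee (s : ℝ) (a b c e : E) : S.J [curv s, sec a, sec b, sec c, sec e] = 0 := by
  simp [J, splitSum, jacobiTerm, passSign, swapSign_eq, ev_nil, ev_one, ev_two, ev_three, ev_four,
    ev_five, ev_six]
  simp only [P_eq, K, Q, Jac, S.br_skew (S.D _), map_sub, map_add, map_neg, LinearMap.sub_apply,
    LinearMap.add_apply, LinearMap.neg_apply, S.br_skew c a, S.br_skew e a, S.br_skew e b,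
    S.br_skew b (S.br _ _), S.br_skew c (S.br _ _), S.br_skew e (S.br _ _),
    S.br_skew (S.br c e) (S.br a b), S.br_skew (S.br b e) (S.br a c),
    S.br_skew (S.br b c) (S.br a e)]
  module

theorem J_ceeef (s : ℝ) (a b c : E) (f : V) : S.J [curv s, sec a, sec b, sec c, fn f] = 0 := by
  simp [J, splitSum, jacobiTerm, passSign, swapSign_eq, ev_nil, ev_one, ev_two, ev_three, ev_four,
    ev_five, ev_six]
  simp only [P_eq, N_smul, N_sub, N_neg, K, Q, Jac, S.br_skew (S.D f), S.N_swap₁ (S.D f), N_D,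
    S.br_skew c a, map_sub, map_add, map_neg, LinearMap.sub_apply, LinearMap.add_apply,
    LinearMap.neg_apply, S.inner_symm (S.D f) (S.D _)]
  module

set_option maxHeartbeats 2000000 in
theorem J_ceeeee (s : ℝ) (a b c e g : E) :
    S.J [curv s, sec a, sec b, sec c, sec e, sec g] = 0 := by
  simp [J, splitSum, jacobiTerm, passSign, swapSign_eq, ev_nil, ev_one, ev_two, ev_three, ev_four,
    ev_five, ev_six]
  -- The orientations of brackets and of N([·,·],[·,·],·) are normalized so that equal terms become
  -- syntactically equal and `module` can cancel them.
  simp only [P_eq, N_smul, N_sub, N_add, N_neg, Q, Jac, N_D, S.br_skew c a, S.br_skew e a,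
    S.br_skew g a, S.br_skew e b, S.br_skew g b, S.br_skew g c, map_sub, map_add, map_neg,
    LinearMap.neg_apply, S.N_swap₁ (S.br a _) (S.br b _), S.N_swap₁ (S.br a _) (S.br c _),
    S.N_swap₁ (S.br a _) (S.br e _), S.N_swap₁ (S.br b _) (S.br c _),
    S.N_swap₁ (S.br b _) (S.br e _)]
  module

/-! ### Reduction of arbitrary arguments to the sorted cases. -/

theorem ev_zero_cons (L : List (V × E × ℝ)) : S.ev (0 :: L) = 0 := by
  simpa using listEval_smul_cons S.mu 0 0 L

theorem ev_smul_cons (r : ℝ) (w : V × E × ℝ) (L : List (V × E × ℝ)) :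
    S.ev (r • w :: L) = r • S.ev (w :: L) := listEval_smul_cons S.mu r w L

theorem jacobiTerm_mu (A B : List (HomElt V E)) : jacobiTerm S.mu val A B =
    (-1 : ℤ) ^ B.length • S.ev (S.ev (A.map val) :: B.map val) := rfl

theorem ev_map_eq_zero_or (A : List (HomElt V E)) : S.ev (A.map val) = 0 ∨
    ∃ y : HomElt V E, y.val = S.ev (A.map val) ∧ y.deg = (A.map deg).sum + 2 - A.length :=
  exists_val_of_mem_gr (S.ev_mem_gr A)

/-- The inner map of arity j and the outer one of arity n - j + 1 have total degree 3 - n. -/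
theorem J_mem_gr (L : List (HomElt V E)) :
    S.J L ∈ gr V E ((L.map deg).sum + 3 - L.length) := by
  refine splitSum_mem (gr V E _).toAddSubgroup _ L fun A B h => ?_
  refine AddSubgroup.zsmul_mem _ ?_ _
  have hs : (A.map deg).sum + (B.map deg).sum = (L.map deg).sum := by
    rw [← (h.map deg).sum_eq, List.map_append, List.sum_append]
  have hl : A.length + B.length = L.length := by rw [← h.length_eq, List.length_append]
  change S.ev (S.ev (A.map val) :: B.map val) ∈ gr V E _
  rcases S.ev_map_eq_zero_or A with h₀ | ⟨y, hy, hd⟩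
  · rw [h₀, ev_zero_cons]
    exact zero_mem _
  · rw [← hy, ← List.map_cons]
    convert S.ev_mem_gr (y :: B) using 1
    simp only [List.map_cons, List.sum_cons, hd, List.length_cons]
    push_cast
    rw [← hs, ← hl]
    push_cast
    ring_nf

theorem ev_curv_curv (s t : ℝ) (L : List (HomElt V E)) {L' : List (HomElt V E)}
    (h : L.Perm (curv s :: curv t :: L')) :
    S.ev (L.map val) = 0 := by
  refine S.ev_eq_zero L fun hs => ?_
  have h₁ : 2 ≤ Multiset.count 2 (↑(L.map deg) : Multiset ℤ) := by
    rw [Multiset.coe_eq_coe.2 (h.map deg)]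
    simp
  have h₂ : ∀ m ∈ supp, Multiset.count 2 m ≤ 1 := by
    rintro m (rfl | rfl | rfl | rfl | rfl | rfl | rfl | rfl | rfl) <;> decide
  exact absurd (h₂ _ hs) (by omega)

theorem val_curv_eq_smul (s : ℝ) : (curv s : HomElt V E).val = s • (curv 1 : HomElt V E).val := by
  simp

theorem ev_curv_cons (s : ℝ) (L : List (V × E × ℝ)) :
    S.ev ((curv s).val :: L) = s • S.ev ((curv 1).val :: L) := by
  rw [val_curv_eq_smul, ev_smul_cons]

theorem jacobiTerm_curv_left (s : ℝ) (A B : List (HomElt V E)) :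
    jacobiTerm S.mu val (curv s :: A) B = s • jacobiTerm S.mu val (curv 1 :: A) B := by
  simp only [jacobiTerm_mu, List.map_cons, S.ev_curv_cons s, ev_smul_cons]
  rw [smul_comm]

/-- The curvature is swapped to the front, where linearity is available, and swapped back; the sign
does not depend on the scalar. -/
theorem jacobiTerm_curv_right (s : ℝ) (A B : List (HomElt V E)) :
    jacobiTerm S.mu val A (curv s :: B) = s • jacobiTerm S.mu val A (curv 1 :: B) := by
  simp only [jacobiTerm_mu, List.map_cons, List.length_cons]
  rcases S.ev_map_eq_zero_or A with h₀ | ⟨y, hy, -⟩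
  · rw [h₀]
    simp only [ev_zero_cons, smul_zero]
  · have h := fun t => S.ev_swap y (curv t) [] (B.map val)
    simp only [List.nil_append] at h
    rw [← hy, h, h, S.ev_curv_cons s, smul_comm s, smul_comm s]
    rcases y with f | e | c <;> simp only [swapSign_eq]

theorem jacobiTerm_curv_curv_left (s t : ℝ) (A B : List (HomElt V E)) :
    jacobiTerm S.mu val (curv s :: curv t :: A) B = 0 := by
  simp only [jacobiTerm_mu]
  rw [S.ev_curv_curv s t _ (List.Perm.refl _), ev_zero_cons, smul_zero]

theorem jacobiTerm_curv_curv_right (s t : ℝ) (A B : List (HomElt V E)) :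
    jacobiTerm S.mu val A (curv s :: curv t :: B) = 0 := by
  simp only [jacobiTerm_mu]
  rcases S.ev_map_eq_zero_or A with h₀ | ⟨y, hy, -⟩
  · rw [h₀, ev_zero_cons, smul_zero]
  · rw [← hy, ← List.map_cons, S.ev_curv_curv s t (L' := y :: B), smul_zero]
    exact (List.Perm.swap _ _ _).trans ((List.Perm.swap _ _ _).cons _)

/-- Splittings with both curvatures in one block vanish, because no supported combination of degrees
contains 2 twice. The two ways to separate them give the same term with opposite signs, since
exchanging two elements of degree 2 costs -1. -/
theorem J_curv_curv (s t : ℝ) (L : List (HomElt V E)) : S.J (curv s :: curv t :: L) = 0 := by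
  have hp : ∀ (r : ℝ) (A : List (HomElt V E)),
      passSign deg (curv r) A = passSign deg (curv 1) A := fun r A => rfl
  have hs : ∀ A : List (HomElt V E), passSign deg (curv s) (curv t :: A) =
      -passSign deg (curv 1) A := fun A => by
    rw [← hp s A]
    simp [passSign, swapSign_eq]
  have e₁ : ∀ A B : List (HomElt V E), passSign deg (curv t) A •
      jacobiTerm S.mu val (curv s :: A) (curv t :: B) = passSign deg (curv 1) A •
      ((t * s) • jacobiTerm S.mu val (curv 1 :: A) (curv 1 :: B)) := fun A B => by
    rw [hp, jacobiTerm_curv_right, jacobiTerm_curv_left, smul_smul]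
  have e₂ : ∀ A B : List (HomElt V E), passSign deg (curv s) (curv t :: A) •
      jacobiTerm S.mu val (curv t :: A) (curv s :: B) = (-1 : ℤ) • (passSign deg (curv 1) A •
      ((t * s) • jacobiTerm S.mu val (curv 1 :: A) (curv 1 :: B))) := fun A B => by
    rw [hs, jacobiTerm_curv_right, jacobiTerm_curv_left, smul_smul, mul_comm t, neg_smul,
      neg_one_smul]
  simp only [J, splitSum, jacobiTerm_curv_curv_left, jacobiTerm_curv_curv_right, smul_zero, e₁, e₂,
    splitSum_smul (-1)]
  have hz : ∀ L : List (HomElt V E), splitSum deg (fun _ _ => (0 : V × E × ℝ)) L = 0 := fun L => by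
    simpa using splitSum_smul (dg := deg) 0 (fun _ _ => (0 : V × E × ℝ)) L
  rw [hz]
  simp

/-- Homogeneous elements can be sorted by type. -/
theorem exists_perm_sorted (L : List (HomElt V E)) : ∃ (cs : List ℝ) (es : List E) (fs : List V),
    L.Perm (cs.map curv ++ (es.map sec ++ fs.map fn)) := by
  induction L with
  | nil => exact ⟨[], [], [], List.Perm.refl _⟩
  | cons x L ih =>
    obtain ⟨cs, es, fs, h⟩ := ih
    rcases x with f | e | c
    · refine ⟨cs, es, f :: fs, (h.cons _).trans ?_⟩
      rw [List.map_cons, ← List.append_assoc, ← List.append_assoc]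
      exact List.perm_middle.symm
    · refine ⟨cs, e :: es, fs, (h.cons _).trans ?_⟩
      rw [List.map_cons, List.cons_append]
      exact List.perm_middle.symm
    · exact ⟨c :: cs, es, fs, h.cons _⟩

theorem J_sorted (cs : List ℝ) (es : List E) (fs : List V) :
    S.J (cs.map curv ++ (es.map sec ++ fs.map fn)) = 0 := by
  rcases cs with _ | ⟨s, _ | ⟨t, cs⟩⟩
  · by_contra hne
    have hd := S.J_mem_gr (([] : List ℝ).map curv ++ (es.map sec ++ fs.map fn))
    -- With p sections and q functions the value has degree 3 - p - 2q, which must be 2, 0 or -1.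
    have hk : es.length + 2 * fs.length = 1 ∨ es.length + 2 * fs.length = 3 ∨
        es.length + 2 * fs.length = 4 := by
      by_contra! hk
      refine hne (eq_zero_of_mem_gr hd ?_ ?_ ?_) <;>
      · simp [Function.comp_def]
        omega
    rcases es with _ | ⟨a, _ | ⟨b, _ | ⟨c, _ | ⟨e, _ | ⟨g, es⟩⟩⟩⟩⟩ <;>
      rcases fs with _ | ⟨f, _ | ⟨f', _ | ⟨f'', fs⟩⟩⟩ <;>
      simp only [List.length_cons, List.length_nil] at hk <;> first | omega | skip
    · exact hne (S.J_ff _ _)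
    · exact hne (S.J_e _)
    · exact hne (S.J_ef _ _)
    · exact hne (S.J_eef _ _ _)
    · exact hne (S.J_eee _ _ _)
    · exact hne (S.J_eeee _ _ _ _)
  · by_contra hne
    have hd := S.J_mem_gr ([s].map curv ++ (es.map sec ++ fs.map fn))
    -- One curvature argument raises this degree by one, to 4 - p - 2q.
    have hk : es.length + 2 * fs.length = 2 ∨ es.length + 2 * fs.length = 4 ∨
        es.length + 2 * fs.length = 5 := by
      by_contra! hk
      refine hne (eq_zero_of_mem_gr hd ?_ ?_ ?_) <;>
      · simp [Function.comp_def]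
        omega
    rcases es with _ | ⟨a, _ | ⟨b, _ | ⟨c, _ | ⟨e, _ | ⟨g, _ | ⟨h, es⟩⟩⟩⟩⟩⟩ <;>
      rcases fs with _ | ⟨f, _ | ⟨f', _ | ⟨f'', fs⟩⟩⟩ <;>
      simp only [List.length_cons, List.length_nil] at hk <;> first | omega | skip
    · exact hne (S.J_cf _ _)
    · exact hne (S.J_cff _ _ _)
    · exact hne (S.J_ceff _ _ _ _)
    · exact hne (S.J_cee _ _ _)
    · exact hne (S.J_ceef _ _ _ _)
    · exact hne (S.J_ceeef _ _ _ _ _)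
    · exact hne (S.J_ceeee _ _ _ _ _)
    · exact hne (S.J_ceeeee _ _ _ _ _ _)
  · exact S.J_curv_curv s t _

theorem J_eq_zero (L : List (HomElt V E)) : S.J L = 0 := by
  obtain ⟨cs, es, fs, h⟩ := exists_perm_sorted L
  obtain ⟨s, hs⟩ := exists_splitSum_perm (Y := V × E × ℝ) (dg := deg) h
  rw [J, hs _ S.splitAntisymm_jacobiTerm]
  exact smul_eq_zero_of_right _ (S.J_sorted cs es fs)

/-! ### Back from lists to families indexed by `Fin n`. -/

section Families

variable {n : ℕ} {dg : Fin n → ℤ} {l : Fin n → V × E × ℝ}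

/-- Families of nonzero homogeneous elements. -/
theorem exists_coord_zero_or_exists_family (hl : ∀ i, l i ∈ gr V E (dg i)) :
    (∃ i, l i = 0) ∨ ∃ x : Fin n → HomElt V E, (fun i => (x i).val) = l ∧
      (fun i => (x i).deg) = dg := by
  by_cases h : ∃ i, l i = 0
  · exact Or.inl h
  · push Not at h
    choose x hx using fun i => (exists_val_of_mem_gr (hl i)).resolve_left (h i)
    exact Or.inr ⟨x, funext fun i => (hx i).1, funext fun i => (hx i).2⟩

theorem mu_family (x : Fin n → HomElt V E) :
    S.mu n (fun i => (x i).val) = S.ev ((List.ofFn x).map val) := by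
  rw [List.map_ofFn]
  exact (listEval_ofFn S.mu _).symm

theorem mu_mem_gr (hl : ∀ i, l i ∈ gr V E (dg i)) : S.mu n l ∈ gr V E ((∑ i, dg i) + 2 - n) := by
  rcases exists_coord_zero_or_exists_family hl with ⟨i, h⟩ | ⟨x, rfl, rfl⟩
  · rw [(S.mu n).map_coord_zero i h]
    exact zero_mem _
  · rw [mu_family]
    convert S.ev_mem_gr (List.ofFn x) using 1
    rw [List.map_ofFn, List.sum_ofFn, List.length_ofFn]
    rfl

theorem mu_eq_zero (hl : ∀ i, l i ∈ gr V E (dg i)) (h : Finset.univ.val.map dg ∉ supp) :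
    S.mu n l = 0 := by
  rcases exists_coord_zero_or_exists_family hl with ⟨i, h₀⟩ | ⟨x, rfl, rfl⟩
  · exact (S.mu n).map_coord_zero i h₀
  · rw [mu_family]
    refine S.ev_eq_zero _ ?_
    rw [Fin.univ_val_map] at h
    rw [List.map_ofFn]
    exact h

theorem mu_swap (hl : ∀ i, l i ∈ gr V E (dg i)) {r s : Fin n} (hrs : r.val + 1 = s.val) :
    S.mu n l = ((dg r * dg s + 1).negOnePow : ℤ) • S.mu n (l ∘ Equiv.swap r s) := by
  rcases exists_coord_zero_or_exists_family hl with ⟨i, h⟩ | ⟨x, rfl, rfl⟩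
  · rw [(S.mu n).map_coord_zero i h, (S.mu n).map_coord_zero (Equiv.swap r s i) (by simpa using h),
      smul_zero]
  · have hsplit : ∀ y : Fin n → V × E × ℝ, List.ofFn y =
        (List.ofFn y).take r ++ y r :: y s :: (List.ofFn y).drop (s + 1) := fun y => by
      have h₁ := List.drop_eq_getElem_cons (l := List.ofFn y) (i := r) (by simp)
      have h₂ := List.drop_eq_getElem_cons (l := List.ofFn y) (i := s) (by simp)
      rw [hrs] at h₁
      rw [h₂] at h₁
      simp only [List.getElem_ofFn, Fin.eta] at h₁
      rw [← h₁, List.take_append_drop]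
    have ht : (List.ofFn ((fun i => (x i).val) ∘ Equiv.swap r s)).take r =
        (List.ofFn fun i => (x i).val).take r := by
      refine List.ext_getElem (by simp) fun m h₁ _ => ?_
      simp only [List.length_take, List.length_ofFn, lt_min_iff] at h₁
      simp only [List.getElem_take, List.getElem_ofFn, Function.comp_apply]
      rw [Equiv.swap_apply_of_ne_of_ne] <;> simp only [ne_eq, Fin.ext_iff] <;> omega
    have hdr : (List.ofFn ((fun i => (x i).val) ∘ Equiv.swap r s)).drop (s + 1) =
        (List.ofFn fun i => (x i).val).drop (s + 1) := by
      refine List.ext_getElem (by simp) fun m h₁ _ => ?_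
      simp only [List.getElem_drop, List.getElem_ofFn, Function.comp_apply]
      rw [Equiv.swap_apply_of_ne_of_ne] <;> simp only [ne_eq, Fin.ext_iff] <;> omega
    rw [← listEval_ofFn, ← listEval_ofFn, hsplit, hsplit (_ ∘ _), ht, hdr]
    simp only [Function.comp_apply, Equiv.swap_apply_left, Equiv.swap_apply_right]
    -- `swapSign` multiplies the two degrees in the opposite order.
    rw [mul_comm]
    exact S.ev_swap _ _ _ _

theorem jacobiator_eq_zero (hl : ∀ i, l i ∈ gr V E (dg i)) : jacobiator S.mu n dg l = 0 := by
  rcases exists_coord_zero_or_exists_family hl with ⟨i, h⟩ | ⟨x, rfl, rfl⟩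
  · exact jacobiator_eq_zero_of_coord S.mu _ _ i h
  · rw [jacobiator_eq_splitSum S.mu val deg x]
    exact S.J_eq_zero _

end Families

theorem isInternal_gr : DirectSum.IsInternal (gr V E) := by
  classical
  refine (DirectSum.isInternal_submodule_iff_iSupIndep_and_iSup_eq_top _).2 ⟨fun i => ?_, ?_⟩
  -- Independence: the sum of the other degrees lies in the product submodule whose coordinate of
  -- degree i is zero.
  · have hle : ⨆ j, ⨆ (_ : j ≠ i), gr V E j ≤ Submodule.prod (if i = -1 then ⊥ else ⊤)
        (Submodule.prod (if i = 0 then ⊥ else ⊤) (if i = 2 then ⊥ else ⊤)) := by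
      refine iSup₂_le fun j hj w hw => ?_
      obtain ⟨h₁, h₂, h₃⟩ := mem_gr.1 hw
      simp only [Submodule.mem_prod]
      refine ⟨?_, ?_, ?_⟩ <;> split_ifs with h <;> simp
      · exact h₁ (h ▸ hj)
      · exact h₂ (h ▸ hj)
      · exact h₃ (h ▸ hj)
    refine Disjoint.mono_right hle (Submodule.disjoint_def.2 fun w hw hw' => ?_)
    obtain ⟨h₁, h₂, h₃⟩ := mem_gr.1 hw
    obtain ⟨k₁, k₂, k₃⟩ := by simpa only [Submodule.mem_prod] using hw'
    refine Prod.ext ?_ (Prod.ext ?_ ?_)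
    · by_cases h : i = -1
      · simpa [h] using k₁
      · exact h₁ h
    · by_cases h : i = 0
      · simpa [h] using k₂
      · exact h₂ h
    · by_cases h : i = 2
      · simpa [h] using k₃
      · exact h₃ h
  · refine eq_top_iff.2 fun w _ => ?_
    have hw : w = (w.1, 0, 0) + (0, w.2.1, 0) + (0, 0, w.2.2) := by ext <;> simp
    rw [hw]
    exact add_mem (add_mem (Submodule.mem_iSup_of_mem (-1) (by simp [mem_gr]))
      (Submodule.mem_iSup_of_mem 0 (by simp [mem_gr])))
      (Submodule.mem_iSup_of_mem 2 (by simp [mem_gr]))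

end MetricBracket

/-! ### From a DFT algebroid to its metric bracket. -/

namespace AlgebroidData

variable {d : ℕ} {M : Type*} [TopologicalSpace M] [ChartedSpace (DoubledSpace d) M]
  [IsManifold 𝓘(ℝ, DoubledSpace d) ∞ M]
  {F : Type*} [NormedAddCommGroup F] [NormedSpace ℝ F]
  {L : M → Type*} [∀ x, AddCommGroup (L x)] [∀ x, Module ℝ (L x)] [∀ x, TopologicalSpace (L x)]
  [TopologicalSpace (TotalSpace F L)] [FiberBundle F L] [VectorBundle ℝ F L]

theorem anchorDual_add (A : AlgebroidData d M F L) (f g : Fn d M) (x : M) :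
    A.anchorDual (f + g) x = A.anchorDual f x + A.anchorDual g x := by
  have hf : MDifferentiableAt 𝓘(ℝ, DoubledSpace d) 𝓘(ℝ, ℝ) f x :=
    f.contMDiff.mdifferentiable (by simp) x
  have hg : MDifferentiableAt 𝓘(ℝ, DoubledSpace d) 𝓘(ℝ, ℝ) g x :=
    g.contMDiff.mdifferentiable (by simp) x
  have h : mvfderiv 𝓘(ℝ, DoubledSpace d) (f + g : Fn d M) x =
      mvfderiv 𝓘(ℝ, DoubledSpace d) f x + mvfderiv 𝓘(ℝ, DoubledSpace d) g x :=
    mfderiv_add hf hg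
  rw [anchorDual, h, ContinuousLinearMap.add_comp]
  rfl

theorem anchorDual_smul (A : AlgebroidData d M F L) (r : ℝ) (f : Fn d M) (x : M) :
    A.anchorDual (r • f) x = r • A.anchorDual f x := by
  have hf : MDifferentiableAt 𝓘(ℝ, DoubledSpace d) 𝓘(ℝ, ℝ) f x :=
    f.contMDiff.mdifferentiable (by simp) x
  have h : mvfderiv 𝓘(ℝ, DoubledSpace d) (r • f : Fn d M) x =
      r • mvfderiv 𝓘(ℝ, DoubledSpace d) f x :=
    const_smul_mfderiv hf r
  rw [anchorDual, h, ContinuousLinearMap.smul_comp]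
  rfl

/-- The pairing of sections as a bilinear map. -/
noncomputable def innerₗ (A : AlgebroidData d M F L) :
    Sec d M F L →ₗ[ℝ] Sec d M F L →ₗ[ℝ] Fn d M :=
  LinearMap.mk₂ ℝ A.inner
    (fun a b c => ContMDiffMap.ext fun x => by
      change A.form x (a x + b x) (c x) = A.form x (a x) (c x) + A.form x (b x) (c x)
      rw [map_add, _root_.add_apply])
    (fun r a b => ContMDiffMap.ext fun x => by
      change A.form x (r • a x) (b x) = r • A.form x (a x) (b x)
      rw [map_smul, _root_.smul_apply])
    (fun a b c => ContMDiffMap.ext fun x => map_add (A.form x (a x)) (b x) (c x))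
    (fun r a b => ContMDiffMap.ext fun x => map_smul (A.form x (a x)) r (b x))

/-- The map `𝓓` as a linear map. -/
noncomputable def Dₗ [FiniteDimensional ℝ F] [∀ x, IsTopologicalAddGroup (L x)]
    [∀ x, ContinuousSMul ℝ (L x)] [ContMDiffVectorBundle ∞ F L 𝓘(ℝ, DoubledSpace d)]
    (A : AlgebroidData d M F L) : Fn d M →ₗ[ℝ] Sec d M F L where
  toFun := A.D
  map_add' f g := by
    ext x
    change (A.form x).inverse ((1 / 2 : ℝ) • A.anchorDual (f + g) x) =
      (A.form x).inverse ((1 / 2 : ℝ) • A.anchorDual f x) +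
        (A.form x).inverse ((1 / 2 : ℝ) • A.anchorDual g x)
    rw [anchorDual_add, smul_add, map_add]
  map_smul' r f := by
    ext x
    change (A.form x).inverse ((1 / 2 : ℝ) • A.anchorDual (r • f) x) =
      r • (A.form x).inverse ((1 / 2 : ℝ) • A.anchorDual f x)
    rw [anchorDual_smul, smul_comm, map_smul]

end AlgebroidData

namespace DFTAlgebroid

variable {d : ℕ} {M : Type*} [TopologicalSpace M] [ChartedSpace (DoubledSpace d) M]
  [IsManifold 𝓘(ℝ, DoubledSpace d) ∞ M] {η : ODDMetric d M}
  {F : Type*} [NormedAddCommGroup F] [NormedSpace ℝ F] [FiniteDimensional ℝ F]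
  {L : M → Type*} [∀ x, AddCommGroup (L x)] [∀ x, Module ℝ (L x)]
  [∀ x, TopologicalSpace (L x)] [∀ x, IsTopologicalAddGroup (L x)]
  [∀ x, ContinuousSMul ℝ (L x)] [TopologicalSpace (TotalSpace F L)] [FiberBundle F L]
  [VectorBundle ℝ F L] [ContMDiffVectorBundle ∞ F L 𝓘(ℝ, DoubledSpace d)]

/-- The bracket, pairing and derivative of a DFT algebroid on sections and functions. -/
noncomputable def metricBracket (A : DFTAlgebroid η F L) :
    MetricBracket (Fn d M) (Sec d M F L) where
  inner := A.innerₗ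
  D := A.Dₗ
  br := A.bracket
  inner_symm a b := ContMDiffMap.ext fun x => A.form_symm x (a x) (b x)
  br_skew := A.bracket_skew
  compat a b c := by
    refine (A.compat a b c).trans ?_
    change _ = (2 : ℝ) • A.inner c (A.D (A.inner a b))
    have h : A.inner c (A.D (A.inner a b)) = A.inner (A.D (A.inner a b)) c :=
      ContMDiffMap.ext fun x => A.form_symm x _ _
    -- The factor 2 in `MetricBracket` cancels the ½ in the definition of 𝓓.
    rw [h, AlgebroidData.form_D, smul_smul]
    norm_num

/-- The curved `L∞`-algebra of a DFT algebroid. -/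
noncomputable def curvedLInfty (A : DFTAlgebroid η F L) :
    LInfty.CurvedLInftyAlgebra (grading d M F L) where
  isInternal := MetricBracket.isInternal_gr (V := Fn d M) (E := Sec d M F L)
  μ := A.metricBracket.mu
  degree _ _ _ hl := A.metricBracket.mu_mem_gr hl
  antisymm _ _ _ hl _ _ hrs := A.metricBracket.mu_swap hl hrs
  homotopyJacobi _ _ _ hl := A.metricBracket.jacobiator_eq_zero hl

open MetricBracket in
theorem hasMaps_curvedLInfty (A : DFTAlgebroid η F L) : A.HasMaps A.curvedLInfty.μ where
  curvature := rfl
  map_f f := rfl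
  map_ee a b := by
    change A.metricBracket.ev [ofSec a, ofSec b] = _
    rw [ev_two]
    simp [ofSec, metricBracket]
  map_ef e f := by
    change A.metricBracket.ev [ofSec e, ofFn f] = _
    rw [ev_two]
    simp [ofSec, ofFn]
    rfl
  map_eee a b c := by
    change A.metricBracket.ev [ofSec a, ofSec b, ofSec c] = _
    rw [ev_three]
    simp [ofSec, ofFn]
    rfl
  map_mu₀_ef e f := by
    change A.metricBracket.ev [mu₀ d M F L, ofSec e, ofFn f] = _
    rw [ev_three]
    simp [ofSec, ofFn, mu₀]
    rfl
  map_mu₀_ff f g := by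
    change A.metricBracket.ev [mu₀ d M F L, ofFn f, ofFn g] = _
    rw [ev_three]
    simp [ofFn, mu₀]
    rfl
  map_mu₀_eee a b c := by
    change A.metricBracket.ev [mu₀ d M F L, ofSec a, ofSec b, ofSec c] = _
    rw [ev_four]
    simp [ofSec, mu₀]
    rfl
  map_mu₀_eeee a b c e := by
    change A.metricBracket.ev [mu₀ d M F L, ofSec a, ofSec b, ofSec c, ofSec e] = _
    rw [ev_five]
    -- T is half of ⟨Q, ·⟩, so its antisymmetrization is P.
    have hT : ∀ a b c e, A.quart a b c e =
        (1 / 2 : ℝ) • A.metricBracket.inner (A.metricBracket.Q a b c) e := fun a b c e => by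
      rw [Q, map_sub, LinearMap.sub_apply, smul_sub]
      rfl
    have hP : A.quart a b c e - A.quart a b e c + A.quart a c e b - A.quart b c e a =
        A.metricBracket.P a b c e := by
      simp only [hT, ← smul_sub, ← smul_add]
      rfl
    rw [hP]
    simp [ofSec, ofFn, mu₀]
  map_other _ _ _ hl h := A.metricBracket.mu_eq_zero hl h

end DFTAlgebroid

end DFT

theorem mainTheorem1 (d : ℕ)
    (M : Type*) [TopologicalSpace M] [T2Space M] [SigmaCompactSpace M]
    [ChartedSpace (DFT.DoubledSpace d) M] [IsManifold 𝓘(ℝ, DFT.DoubledSpace d) ∞ M]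
    (η : DFT.ODDMetric d M)
    (F : Type*) [NormedAddCommGroup F] [NormedSpace ℝ F] [FiniteDimensional ℝ F]
    (hF : Module.finrank ℝ F = 2 * d)
    (L : M → Type*) [∀ x, AddCommGroup (L x)] [∀ x, Module ℝ (L x)]
    [∀ x, TopologicalSpace (L x)] [∀ x, IsTopologicalAddGroup (L x)]
    [∀ x, ContinuousSMul ℝ (L x)] [TopologicalSpace (TotalSpace F L)] [FiberBundle F L]
    [VectorBundle ℝ F L] [ContMDiffVectorBundle ∞ F L 𝓘(ℝ, DFT.DoubledSpace d)]
    (A : DFT.DFTAlgebroid η F L) :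
    ∃ 𝓛 : LInfty.CurvedLInftyAlgebra (DFT.grading d M F L), A.HasMaps 𝓛.μ :=
  ⟨A.curvedLInfty, A.hasMaps_curvedLInfty⟩
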